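/- There is an absolute constant $K$ such that the following holds. Let $C_1,\dots,C_m$ be finite sets of closed disks of positive radius in the Euclidean plane $\mathbb{R}^2$, each of which is a stabbed clique, that is, for each $i$ some point of the plane lies in all disks of $C_i$. Let $F_i=\bigcup_{D\in C_i} D$ be the corresponding flowers, let $n=\sum_{i=1}^m |C_i|$ be the total number of disks, and let the ply of $\mathcal{F}=(F_i)_{i=1}^m$ be $\mathrm{ply}(\mathcal{F})=\max_{q\in\mathbb{R}^2}|\{i : q\in F_i\}|$. The boundary arcs of $F_i$ are the maximal connected pieces, consisting of more than one point, of $\partial D\cap\partial F_i$ for the disks $D\in C_i$. Then the number of intersections between the boundary arcs of the flowers $F_1,\dots,F_m$ is at most $K\cdot n\cdot \mathrm{ply}(\mathcal{F})$, i.e. it is $O(n\cdot\mathrm{ply}(\mathcal{F}))$. Here all pairs of different boundary arcs are considered, of the same flower or of two different flowers (arcs of $F_i$ and $F_j$ with $i\neq j$ are regarded as different), and the intersections of two arcs $\beta,\beta'$ are the connected components of $\beta\cap\beta'$: these are the common points if $\beta$ and $\beta'$ lie on different circles, and a component may be a common sub-arc if they lie on the same circle. -/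

import Mathlib

/-- The Euclidean plane. -/
abbrev Plane : Type := EuclideanSpace ℝ (Fin 2)

/-- A (closed) disk in the plane, given by its center and its positive radius. -/
structure Disk where
  center : Plane
  radius : ℝ
  radius_pos : 0 < radius

/-- The points of a disk. -/
def Disk.toSet (D : Disk) : Set Plane := Metric.closedBall D.center D.radius

/-- The boundary circle of a disk. -/
def Disk.circle (D : Disk) : Set Plane := Metric.sphere D.center D.radius

/-- A finite set of disks is a stabbed clique if one point lies in all of its disks. -/
def IsStabbedClique (C : Finset Disk) : Prop := ∃ p : Plane, ∀ D ∈ C, p ∈ D.toSet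

/-- The flower of a clique is the union of its disks. -/
def flower (C : Finset Disk) : Set Plane := ⋃ D ∈ C, D.toSet

/-- The boundary arcs of the flower of `C`: the maximal connected pieces of the boundary circle of
a disk of `C` that appear on the boundary of the flower. A piece that is a single point (a point at
which a circle merely touches the boundary of the flower) is not an arc. -/
def boundaryArcs (C : Finset Disk) : Set (Set Plane) :=
  {β | β.Nontrivial ∧ ∃ D ∈ C, ∃ x ∈ D.circle ∩ frontier (flower C),
    β = connectedComponentIn (D.circle ∩ frontier (flower C)) x}

/-- The ply of a family of planar sets: the maximum, over all points `q` of the plane, of the number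
of members of the family that contain `q`. -/
noncomputable def ply {ι : Type*} (S : ι → Set Plane) : ℕ∞ :=
  ⨆ q : Plane, {i | q ∈ S i}.encard

/-- The intersections between the boundary arcs of the flowers of a family of cliques. A boundary
arc is recorded with the index of its flower, and an intersection of two different boundary arcs
`a`, `b` (of the same flower or of different flowers) is a connected component of the set of their
common points: this is a single common point when the arcs lie on different circles, and it may be a
common sub-arc when they lie on the same circle. Every intersection is listed for both orders of
the two arcs. -/
def arcIntersections {ι : Type*} (C : ι → Finset Disk) :
    Set ((ι × Set Plane) × (ι × Set Plane) × Set Plane) :=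
  {(a, b, I) | a.2 ∈ boundaryArcs (C a.1) ∧ b.2 ∈ boundaryArcs (C b.1) ∧ a ≠ b ∧
    ∃ x ∈ a.2 ∩ b.2, I = connectedComponentIn (a.2 ∩ b.2) x}

/-! Charge every intersection to the arc of smaller diameter. Let `A` be an arc of diameter d. A
longer arc meeting `A` lies on a circle of diameter at least d, so its disk contains a disk of
diameter d close to `A`, and hence one of boundedly many sample points near `A`. A sample point lies
in at most ply flowers, so O(ply) flowers own such arcs. One flower contributes boundedly many: by
`encard_long_arcs_le`, at most 8 of its arcs meet a given disk of radius ρ and also get 40ρ away,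
since of two different arcs running side by side in the same direction, one would enter the open
disk of the other. So `A` has O(ply) longer neighbors, with at most two intersections each.

It remains to see that there are O(n) arcs; only here are the cliques required to be stabbed.
Inversion at the stabbing point turns the complement of each open disk into a closed disk or
half-plane. Charge a vertex of the union to the larger of the two images that meet there; each
circle is charged at most twice (`encard_crossings_on_circle_le`). Every arc is a whole circle or
contains a vertex, and at most 8 arcs pass through a point. -/

open Real

/-! ### Coordinates and the angular parametrization of circles. -/

theorem Plane.dist_sq (x y : Plane) : dist x y ^ 2 = (x 0 - y 0) ^ 2 + (x 1 - y 1) ^ 2 := by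
  rw [EuclideanSpace.dist_eq, Real.sq_sqrt (by positivity), Fin.sum_univ_two, Real.dist_eq,
    Real.dist_eq, sq_abs, sq_abs]

theorem Plane.ext {x y : Plane} (h0 : x 0 = y 0) (h1 : x 1 = y 1) : x = y := by
  ext i
  fin_cases i
  · exact h0
  · exact h1

theorem Disk.mem_circle_iff (D : Disk) (x : Plane) :
    x ∈ D.circle ↔ (x 0 - D.center 0) ^ 2 + (x 1 - D.center 1) ^ 2 = D.radius ^ 2 := by
  rw [← Plane.dist_sq, Disk.circle, Metric.mem_sphere,
    pow_left_inj₀ dist_nonneg D.radius_pos.le two_ne_zero]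

theorem Disk.mem_toSet_iff (D : Disk) (x : Plane) :
    x ∈ D.toSet ↔ (x 0 - D.center 0) ^ 2 + (x 1 - D.center 1) ^ 2 ≤ D.radius ^ 2 := by
  rw [← Plane.dist_sq, Disk.toSet, Metric.mem_closedBall,
    pow_le_pow_iff_left₀ dist_nonneg D.radius_pos.le two_ne_zero]

theorem Disk.mem_ball_iff (D : Disk) (x : Plane) :
    x ∈ Metric.ball D.center D.radius ↔
      (x 0 - D.center 0) ^ 2 + (x 1 - D.center 1) ^ 2 < D.radius ^ 2 := by
  rw [← Plane.dist_sq, Metric.mem_ball,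
    pow_lt_pow_iff_left₀ dist_nonneg D.radius_pos.le two_ne_zero]

theorem Disk.circle_subset (D : Disk) : D.circle ⊆ D.toSet := Metric.sphere_subset_closedBall

/-- The point of the boundary circle of a disk at a given angle. -/
noncomputable def Disk.point (D : Disk) (θ : ℝ) : Plane :=
  !₂[D.center 0 + D.radius * cos θ, D.center 1 + D.radius * sin θ]

@[simp] theorem Disk.point_zero (D : Disk) (θ : ℝ) :
    D.point θ 0 = D.center 0 + D.radius * cos θ := rfl

@[simp] theorem Disk.point_one (D : Disk) (θ : ℝ) :
    D.point θ 1 = D.center 1 + D.radius * sin θ := rfl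

theorem Disk.continuous_point (D : Disk) : Continuous D.point := by
  unfold Disk.point
  refine (PiLp.continuous_toLp 2 _).comp (continuous_pi fun i => ?_)
  fin_cases i <;> simp <;> fun_prop

theorem Disk.point_mem_circle (D : Disk) (θ : ℝ) : D.point θ ∈ D.circle := by
  rw [D.mem_circle_iff, point_zero, point_one]
  linear_combination D.radius ^ 2 * sin_sq_add_cos_sq θ

theorem Disk.point_add_int_mul (D : Disk) (θ : ℝ) (k : ℤ) :
    D.point (θ + k * (2 * π)) = D.point θ := by
  apply Plane.ext <;> simp

theorem Disk.point_add_two_pi (D : Disk) (θ : ℝ) : D.point (θ + 2 * π) = D.point θ := by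
  apply Plane.ext <;> simp

theorem Disk.exists_point_eq (D : Disk) {x : Plane} (hx : x ∈ D.circle) (α : ℝ) :
    ∃ θ ∈ Set.Ico α (α + 2 * π), D.point θ = x := by
  rw [D.mem_circle_iff] at hx
  have hr := D.radius_pos
  set z : ℂ := ⟨x 0 - D.center 0, x 1 - D.center 1⟩ with hz
  have hn : ‖z‖ = D.radius := by
    rw [← pow_left_inj₀ (norm_nonneg _) hr.le two_ne_zero, ← Complex.normSq_eq_norm_sq,
      Complex.normSq_apply, ← hx, hz]
    ring
  have hz0 : z ≠ 0 := by
    rw [← norm_ne_zero_iff, hn]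
    exact hr.ne'
  have key : D.point z.arg = x := by
    apply Plane.ext
    · rw [point_zero, Complex.cos_arg hz0, hn, mul_div_cancel₀ _ hr.ne']
      simp [hz]
    · rw [point_one, Complex.sin_arg, hn, mul_div_cancel₀ _ hr.ne']
      simp [hz]
  refine ⟨toIcoMod two_pi_pos α z.arg, toIcoMod_mem_Ico _ _ _, ?_⟩
  rw [← key, ← D.point_add_int_mul _ (toIcoDiv two_pi_pos α z.arg), ← zsmul_eq_mul,
    toIcoMod_add_toIcoDiv_zsmul]

theorem Disk.dist_point_le (D : Disk) (α β : ℝ) :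
    dist (D.point α) (D.point β) ≤ D.radius * |α - β| := by
  have hr := D.radius_pos
  rw [← pow_le_pow_iff_left₀ dist_nonneg (by positivity) two_ne_zero, Plane.dist_sq, mul_pow,
    sq_abs]
  have h := one_sub_sq_div_two_le_cos (x := α - β)
  rw [cos_sub] at h
  simp only [point_zero, point_one]
  have e : (D.center 0 + D.radius * cos α - (D.center 0 + D.radius * cos β)) ^ 2 +
      (D.center 1 + D.radius * sin α - (D.center 1 + D.radius * sin β)) ^ 2 =
      D.radius ^ 2 * (2 - 2 * (cos α * cos β + sin α * sin β)) := by
    linear_combination D.radius ^ 2 * (sin_sq_add_cos_sq α + sin_sq_add_cos_sq β)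
  rw [e]
  apply mul_le_mul_of_nonneg_left _ (by positivity)
  linarith

/-! ### Connected subsets of circles and their intersections. -/

theorem Disk.cos_eq_of_mem_line (D : Disk) {u w θ : ℝ}
    (h : cos (θ - (u + w) / 2) = cos ((w - u) / 2)) :
    D.point θ = D.point u ∨ D.point θ = D.point w := by
  rw [Real.cos_eq_cos_iff] at h
  obtain ⟨k, h | h⟩ := h
  · right
    rw [← D.point_add_int_mul θ k]
    congr 1
    linarith
  · left
    rw [← D.point_add_int_mul u k]
    congr 1
    linarith

/-- A connected subset of a circle contains one of the two arcs between any two of its points. -/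
theorem Disk.arc_subset_or (D : Disk) {a : Set Plane} (ha : IsPreconnected a)
    (hac : a ⊆ D.circle) {α β : ℝ} (h1 : α < β) (h2 : β < α + 2 * π)
    (hα : D.point α ∈ a) (hβ : D.point β ∈ a) :
    (∀ θ ∈ Set.Icc α β, D.point θ ∈ a) ∨ ∀ θ ∈ Set.Icc β (α + 2 * π), D.point θ ∈ a := by
  by_contra! hcon
  obtain ⟨⟨u, ⟨hu1, hu2⟩, hu⟩, w, ⟨hw1, hw2⟩, hw⟩ := hcon
  have hu1 : α < u := lt_of_le_of_ne hu1 (by rintro rfl; exact hu hα)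
  have hu2 : u < β := lt_of_le_of_ne hu2 (by rintro rfl; exact hu hβ)
  have hw1 : β < w := lt_of_le_of_ne hw1 (by rintro rfl; exact hw hβ)
  have hw2 : w < α + 2 * π :=
    lt_of_le_of_ne hw2 (by rintro rfl; exact hw (by rwa [D.point_add_two_pi]))
  set m := (u + w) / 2 with hm
  set δ := (w - u) / 2 with hδ
  have hr := D.radius_pos
  -- Signed distance to the line through the two omitted points, at angles `u` and `w`. It separates
  -- the points at `α` and `β`, so the connected set crosses it; but the line meets the circle only
  -- at the omitted points.
  let f : Plane → ℝ := fun x =>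
    (x 0 - D.center 0) * cos m + (x 1 - D.center 1) * sin m - D.radius * cos δ
  have hf : Continuous f := by fun_prop
  have hfp : ∀ θ, f (D.point θ) = D.radius * (cos (θ - m) - cos δ) := by
    intro θ
    simp only [f, Disk.point_zero, Disk.point_one, cos_sub]
    ring
  have hfa : f (D.point α) < 0 := by
    rw [hfp]
    apply mul_neg_of_pos_of_neg hr
    rw [sub_neg, ← cos_neg (α - m)]
    rcases le_total (-(α - m)) π with h | h
    · exact cos_lt_cos_of_nonneg_of_le_pi (by linarith) h (by linarith)
    · rw [← cos_two_pi_sub]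
      exact cos_lt_cos_of_nonneg_of_le_pi (by linarith) (by linarith) (by linarith)
  have hfb : 0 < f (D.point β) := by
    rw [hfp]
    apply mul_pos hr
    rw [sub_pos, ← cos_abs (β - m)]
    exact cos_lt_cos_of_nonneg_of_le_pi (abs_nonneg _) (by linarith)
      (abs_lt.2 ⟨by linarith, by linarith⟩)
  obtain ⟨x, hxa, hx0⟩ := ha.intermediate_value hα hβ hf.continuousOn ⟨hfa.le, hfb.le⟩
  obtain ⟨θ, -, rfl⟩ := D.exists_point_eq (hac hxa) 0
  rw [hfp] at hx0
  have hc : cos (θ - m) = cos δ := by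
    have := (mul_eq_zero.1 hx0).resolve_left hr.ne'
    linarith
  rcases D.cos_eq_of_mem_line hc with h | h
  · exact hu (h ▸ hxa)
  · exact hw (h ▸ hxa)

theorem Disk.eq_of_circle_three {D E : Disk} {x y z : Plane} (hxy : x ≠ y) (hxz : x ≠ z)
    (hyz : y ≠ z) (hxD : x ∈ D.circle) (hyD : y ∈ D.circle) (hzD : z ∈ D.circle)
    (hxE : x ∈ E.circle) (hyE : y ∈ E.circle) (hzE : z ∈ E.circle) : D = E := by
  let s : EuclideanGeometry.Sphere Plane := ⟨D.center, D.radius⟩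
  let t : EuclideanGeometry.Sphere Plane := ⟨E.center, E.radius⟩
  by_contra hne
  have hst : s ≠ t := by
    intro h
    apply hne
    have h1 : D.center = E.center := congrArg EuclideanGeometry.Sphere.center h
    have h2 : D.radius = E.radius := congrArg EuclideanGeometry.Sphere.radius h
    cases D
    cases E
    simp_all
  rcases EuclideanGeometry.eq_of_mem_sphere_of_mem_sphere_of_finrank_eq_two (by simp) hst hxy
    (show x ∈ s from hxD) (show y ∈ s from hyD) (show z ∈ s from hzD) (show x ∈ t from hxE)
    (show y ∈ t from hyE) (show z ∈ t from hzE) with h | h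
  · exact hxz h.symm
  · exact hyz h.symm

theorem Set.encard_le_two_of {α : Type*} {s : Set α}
    (h : ∀ x ∈ s, ∀ y ∈ s, ∀ z ∈ s, x ≠ y → x ≠ z → y ≠ z → False) : s.encard ≤ 2 := by
  by_contra hcon
  have h3 : (3 : ℕ∞) ≤ s.encard := by
    have := Order.add_one_le_of_lt (not_le.1 hcon)
    exact this
  obtain ⟨t, hts, ht⟩ := Set.exists_subset_encard_eq h3
  obtain ⟨x, y, z, hxy, hxz, hyz, rfl⟩ := Set.encard_eq_three.1 ht
  exact h x (hts (by simp)) y (hts (by simp)) z (hts (by simp)) hxy hxz hyz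

theorem connectedComponentIn_eq_of_arc (D : Disk) {S : Set Plane} {α β : ℝ} (h : α ≤ β)
    (hS : ∀ θ ∈ Set.Icc α β, D.point θ ∈ S) :
    connectedComponentIn S (D.point α) = connectedComponentIn S (D.point β) := by
  apply connectedComponentIn_eq
  have hc : IsPreconnected (D.point '' Set.Icc α β) :=
    isPreconnected_Icc.image _ D.continuous_point.continuousOn
  apply hc.subset_connectedComponentIn (Set.mem_image_of_mem _ (Set.left_mem_Icc.2 h))
  · rintro _ ⟨θ, hθ, rfl⟩
    exact hS θ hθ
  · exact Set.mem_image_of_mem _ (Set.right_mem_Icc.2 h)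

/-- A connected set fails to contain at most one of the three arcs, so two connected sets always
have a whole arc in common. -/
theorem Disk.two_of_three_arcs (D : Disk) {a : Set Plane} (ha : IsPreconnected a)
    (hac : a ⊆ D.circle) {α β γ : ℝ} (h1 : α < β) (h2 : β < γ) (h3 : γ < α + 2 * π)
    (hα : D.point α ∈ a) (hβ : D.point β ∈ a) (hγ : D.point γ ∈ a) :
    ((∀ θ ∈ Set.Icc α β, D.point θ ∈ a) ∧ ∀ θ ∈ Set.Icc β γ, D.point θ ∈ a) ∨
    ((∀ θ ∈ Set.Icc α β, D.point θ ∈ a) ∧ ∀ θ ∈ Set.Icc γ (α + 2 * π), D.point θ ∈ a) ∨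
    ((∀ θ ∈ Set.Icc β γ, D.point θ ∈ a) ∧ ∀ θ ∈ Set.Icc γ (α + 2 * π), D.point θ ∈ a) := by
  rcases D.arc_subset_or ha hac h1 (by linarith) hα hβ with h | h
  · rcases D.arc_subset_or ha hac h2 (by linarith) hβ hγ with h' | h'
    · exact Or.inl ⟨h, h'⟩
    · exact Or.inr (Or.inl ⟨h, fun θ hθ => h' θ ⟨hθ.1, by linarith [hθ.2]⟩⟩)
  · exact Or.inr (Or.inr ⟨fun θ hθ => h θ ⟨hθ.1, by linarith [hθ.2]⟩,
      fun θ hθ => h θ ⟨by linarith [hθ.1], hθ.2⟩⟩)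

/-- The intersection of two connected subsets of circles has at most two components. -/
theorem encard_components_inter_le (D E : Disk) {a b : Set Plane} (ha : IsPreconnected a)
    (hb : IsPreconnected b) (haD : a ⊆ D.circle) (hbE : b ⊆ E.circle) :
    {I | ∃ x ∈ a ∩ b, I = connectedComponentIn (a ∩ b) x}.encard ≤ 2 := by
  apply Set.encard_le_two_of
  rintro _ ⟨x, hx, rfl⟩ _ ⟨y, hy, rfl⟩ _ ⟨z, hz, rfl⟩ hxy hxz hyz
  have hxy' : x ≠ y := by rintro rfl; exact hxy rfl
  have hxz' : x ≠ z := by rintro rfl; exact hxz rfl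
  have hyz' : y ≠ z := by rintro rfl; exact hyz rfl
  -- Three components supply three points common to both circles.
  obtain rfl : D = E := Disk.eq_of_circle_three hxy' hxz' hyz' (haD hx.1) (haD hy.1) (haD hz.1)
    (hbE hx.2) (hbE hy.2) (hbE hz.2)
  obtain ⟨α, -, rfl⟩ := D.exists_point_eq (haD hx.1) 0
  obtain ⟨β, ⟨hβ1, hβ2⟩, rfl⟩ := D.exists_point_eq (haD hy.1) α
  obtain ⟨γ, ⟨hγ1, hγ2⟩, rfl⟩ := D.exists_point_eq (haD hz.1) α
  have hβ1 : α < β := lt_of_le_of_ne hβ1 (by rintro rfl; exact hxy' rfl)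
  have hγ1 : α < γ := lt_of_le_of_ne hγ1 (by rintro rfl; exact hxz' rfl)
  have main : ∀ β γ : ℝ, α < β → β < γ → γ < α + 2 * π → D.point β ∈ a ∩ b → D.point γ ∈ a ∩ b →
      connectedComponentIn (a ∩ b) (D.point α) ≠ connectedComponentIn (a ∩ b) (D.point β) →
      connectedComponentIn (a ∩ b) (D.point α) ≠ connectedComponentIn (a ∩ b) (D.point γ) →
      connectedComponentIn (a ∩ b) (D.point β) ≠ connectedComponentIn (a ∩ b) (D.point γ) →
      False := by
    intro β γ h1 h2 h3 hy hz hxy hxz hyz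
    have k1 : ¬ ((∀ θ ∈ Set.Icc α β, D.point θ ∈ a) ∧ ∀ θ ∈ Set.Icc α β, D.point θ ∈ b) :=
      fun h => hxy (connectedComponentIn_eq_of_arc D h1.le fun θ hθ => ⟨h.1 θ hθ, h.2 θ hθ⟩)
    have k2 : ¬ ((∀ θ ∈ Set.Icc β γ, D.point θ ∈ a) ∧ ∀ θ ∈ Set.Icc β γ, D.point θ ∈ b) :=
      fun h => hyz (connectedComponentIn_eq_of_arc D h2.le fun θ hθ => ⟨h.1 θ hθ, h.2 θ hθ⟩)
    have k3 : ¬ ((∀ θ ∈ Set.Icc γ (α + 2 * π), D.point θ ∈ a) ∧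
        ∀ θ ∈ Set.Icc γ (α + 2 * π), D.point θ ∈ b) := by
      intro h
      apply hxz
      have := connectedComponentIn_eq_of_arc (S := a ∩ b) D h3.le
        fun θ hθ => ⟨h.1 θ hθ, h.2 θ hθ⟩
      rw [this, D.point_add_two_pi]
    have ta := D.two_of_three_arcs ha haD h1 h2 h3 hx.1 hy.1 hz.1
    have tb := D.two_of_three_arcs hb hbE h1 h2 h3 hx.2 hy.2 hz.2
    tauto
  rcases lt_trichotomy β γ with h | h | h
  · exact main β γ hβ1 h hγ2 hy hz hxy hxz hyz
  · exact hyz' (by rw [h])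
  · exact main γ β hγ1 h hβ2 hz hy hxz hxy hyz.symm

/-! ### Flowers and their boundary arcs. -/

theorem flower_def (C : Finset Disk) (x : Plane) : x ∈ flower C ↔ ∃ D ∈ C, x ∈ D.toSet := by
  simp [flower]

theorem isClosed_flower (C : Finset Disk) : IsClosed (flower C) :=
  C.finite_toSet.isClosed_biUnion fun _ _ => Metric.isClosed_closedBall

theorem notMem_ball_of_mem_frontier {C : Finset Disk} {D : Disk} (hD : D ∈ C) {x : Plane}
    (hx : x ∈ frontier (flower C)) : x ∉ Metric.ball D.center D.radius := by
  intro h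
  refine hx.2 (mem_interior.2 ⟨_, ?_, Metric.isOpen_ball, h⟩)
  intro y hy
  exact (flower_def C y).2 ⟨D, hD, Metric.ball_subset_closedBall hy⟩

theorem exists_disk_of_mem_boundaryArcs {C : Finset Disk} {b : Set Plane}
    (hb : b ∈ boundaryArcs C) :
    ∃ D ∈ C, b ⊆ D.circle ∩ frontier (flower C) ∧
      ∀ z ∈ b, b = connectedComponentIn (D.circle ∩ frontier (flower C)) z := by
  obtain ⟨-, D, hD, x, -, rfl⟩ := hb
  exact ⟨D, hD, connectedComponentIn_subset _ _, fun z hz => connectedComponentIn_eq hz⟩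

theorem isPreconnected_of_mem_boundaryArcs {C : Finset Disk} {b : Set Plane}
    (hb : b ∈ boundaryArcs C) : IsPreconnected b := by
  obtain ⟨-, D, hD, x, -, rfl⟩ := hb
  exact isPreconnected_connectedComponentIn

/-! ### Long arcs of one flower near a small disk. -/

/-- `b` is, over the points at distance between `ρ` and `3 / 2 * ρ` from `o` on one side (given by
the sign `σ`), a graph over the direction orthogonal to the one at angle `ψ`. -/
def IsGraphNear (D : Disk) (b : Set Plane) (o : Plane) (ρ ψ σ : ℝ) : Prop :=
  ∀ h ∈ Set.Icc ρ (3 / 2 * ρ), ∃ z ∈ b, (z 1 - o 1) * cos ψ - (z 0 - o 0) * sin ψ = σ * h ∧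
    |(z 0 - o 0) * cos ψ + (z 1 - o 1) * sin ψ| ≤ 6 * ρ ∧
    D.radius / 2 ≤ (z 0 - D.center 0) * cos ψ + (z 1 - D.center 1) * sin ψ

theorem Plane.abs_inner_le_dist (x y : Plane) (ψ : ℝ) :
    |(x 0 - y 0) * cos ψ + (x 1 - y 1) * sin ψ| ≤ dist x y := by
  rw [← pow_le_pow_iff_left₀ (abs_nonneg _) dist_nonneg two_ne_zero, Plane.dist_sq, sq_abs]
  nlinarith [sq_nonneg ((x 1 - y 1) * cos ψ - (x 0 - y 0) * sin ψ), sin_sq_add_cos_sq ψ]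

theorem Plane.abs_cross_le_dist (x y : Plane) (ψ : ℝ) :
    |(x 1 - y 1) * cos ψ - (x 0 - y 0) * sin ψ| ≤ dist x y := by
  rw [← pow_le_pow_iff_left₀ (abs_nonneg _) dist_nonneg two_ne_zero, Plane.dist_sq, sq_abs]
  nlinarith [sq_nonneg ((x 0 - y 0) * cos ψ + (x 1 - y 1) * sin ψ), sin_sq_add_cos_sq ψ]

theorem half_le_cos_of_abs_le {x : ℝ} (hx : |x| ≤ π / 3) : 1 / 2 ≤ cos x := by
  rw [← cos_abs x, ← cos_pi_div_three]
  exact cos_le_cos_of_nonneg_of_le_pi (abs_nonneg _) (by linarith [pi_pos]) hx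

theorem half_sub_le_sin_sub {a b : ℝ} (ha : |a| ≤ π / 3) (hb : |b| ≤ π / 3) (hab : a ≤ b) :
    (b - a) / 2 ≤ sin b - sin a := by
  have h := (convex_Icc (-(π / 3)) (π / 3)).mul_sub_le_image_sub_of_le_deriv
    (f := sin) continuous_sin.continuousOn differentiable_sin.differentiableOn (C := 1 / 2)
    (fun x hx => by
      rw [Real.deriv_sin]
      have := interior_subset hx
      exact half_le_cos_of_abs_le (abs_le.2 this))
    a (abs_le.1 ha) b (abs_le.1 hb) hab
  linarith

/-- Follow the circle for length `5 * ρ`, an angle of at most 1/4. The normal then stays within π/4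
+ 1/4 ≤ π/3 of `ψ`, so the height grows at rate at least 1/2 per unit length: from at most `ρ` (and
at least `-ρ`) to at least 5/2 ρ - ρ = 3/2 ρ. The displacement stays below ρ + 5ρ. -/
theorem Disk.isGraphNear_of_arc (D : Disk) {b : Set Plane} {o : Plane} {ρ θ ψ σ : ℝ} (hρ : 0 < ρ)
    (hr : 20 * ρ ≤ D.radius) (hσ : σ = 1 ∨ σ = -1) (hψ : |θ - ψ| ≤ π / 4)
    (hx : dist (D.point θ) o ≤ ρ)
    (hb : ∀ τ ∈ Set.Icc 0 (5 * ρ / D.radius), D.point (θ + σ * τ) ∈ b) :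
    IsGraphNear D b o ρ ψ σ := by
  have hrp := D.radius_pos
  have hσ2 : σ * σ = 1 := by rcases hσ with rfl | rfl <;> norm_num
  have hσa : |σ| = 1 := by rcases hσ with rfl | rfl <;> simp
  set T := 5 * ρ / D.radius with hT
  have hrT : D.radius * T = 5 * ρ := mul_div_cancel₀ _ hrp.ne'
  have hT0 : 0 ≤ T := by positivity
  have hT1 : T ≤ 1 / 4 := by
    rw [hT, div_le_iff₀ hrp]
    linarith
  have habs : ∀ τ ∈ Set.Icc 0 T, |θ + σ * τ - ψ| ≤ π / 3 := by
    intro τ hτ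
    have e : θ + σ * τ - ψ = (θ - ψ) + σ * τ := by ring
    rw [e]
    refine (abs_add_le _ _).trans ?_
    rw [abs_mul, hσa, one_mul, abs_of_nonneg hτ.1]
    linarith [hτ.2, pi_gt_three]
  let H : ℝ → ℝ := fun τ =>
    σ * ((D.point (θ + σ * τ) 1 - o 1) * cos ψ - (D.point (θ + σ * τ) 0 - o 0) * sin ψ)
  have hHc : Continuous H := by
    simp only [H, Disk.point_zero, Disk.point_one]
    fun_prop
  have hH : ∀ τ, H τ = σ * ((D.center 1 - o 1) * cos ψ - (D.center 0 - o 0) * sin ψ) +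
      D.radius * (σ * sin (θ + σ * τ - ψ)) := by
    intro τ
    simp only [H, Disk.point_zero, Disk.point_one]
    rw [sin_sub (θ + σ * τ)]
    ring
  have hH0 : |H 0| ≤ ρ := by
    simp only [H, mul_zero, add_zero, abs_mul, hσa, one_mul]
    exact (Plane.abs_cross_le_dist _ _ _).trans hx
  have hHT : 3 / 2 * ρ ≤ H T := by
    have h0 := habs 0 ⟨le_rfl, hT0⟩
    have h1 := habs T ⟨hT0, le_rfl⟩
    have key : T / 2 ≤ σ * sin (θ + σ * T - ψ) - σ * sin (θ + σ * 0 - ψ) := by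
      rcases hσ with rfl | rfl
      · have := half_sub_le_sin_sub h0 h1 (by linarith)
        linarith
      · have := half_sub_le_sin_sub h1 h0 (by linarith)
        linarith
    have h2 := mul_le_mul_of_nonneg_left key hrp.le
    have h3 := hH T
    have h4 := hH 0
    have h5 := abs_le.1 hH0
    nlinarith
  intro h hh
  obtain ⟨τ, hτ, hτh⟩ := intermediate_value_Icc hT0 hHc.continuousOn
    (show h ∈ Set.Icc (H 0) (H T) from
      ⟨(le_abs_self _).trans (hH0.trans hh.1), hh.2.trans hHT⟩)
  refine ⟨D.point (θ + σ * τ), hb τ hτ, ?_, ?_, ?_⟩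
  · rw [← hτh]
    simp only [H]
    rw [← mul_assoc, hσ2, one_mul]
  · refine (Plane.abs_inner_le_dist _ _ _).trans ?_
    refine (dist_triangle _ (D.point θ) _).trans ?_
    have h1 := D.dist_point_le (θ + σ * τ) θ
    rw [add_sub_cancel_left, abs_mul, hσa, one_mul, abs_of_nonneg hτ.1] at h1
    have h2 := mul_le_mul_of_nonneg_left hτ.2 hrp.le
    linarith
  · have h1 := half_le_cos_of_abs_le (habs τ hτ)
    have h2 := mul_le_mul_of_nonneg_left h1 hrp.le
    rw [cos_sub] at h2
    simp only [Disk.point_zero, Disk.point_one]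
    linarith

theorem exists_quadrant {θ : ℝ} (h : θ ∈ Set.Ico (-(π / 4)) (-(π / 4) + 2 * π)) :
    ∃ j : Fin 4, |θ - (j : ℕ) * (π / 2)| ≤ π / 4 := by
  obtain ⟨h1, h2⟩ := h
  have hp := pi_pos
  rcases le_total θ (π / 4) with h3 | h3
  · exact ⟨0, abs_le.2 ⟨by simp; linarith, by simp; linarith⟩⟩
  rcases le_total θ (3 * π / 4) with h4 | h4
  · exact ⟨1, abs_le.2 ⟨by simp; linarith, by simp; linarith⟩⟩
  rcases le_total θ (5 * π / 4) with h5 | h5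
  · exact ⟨2, abs_le.2 ⟨by simp; linarith, by simp; linarith⟩⟩
  · exact ⟨3, abs_le.2 ⟨by simp; linarith, by simp; linarith⟩⟩

/-- The set contains one of the two arcs from `x` to `y`, whose length is at least the chord `40 *
ρ` and so exceeds the needed `5 * ρ`. The index records the quadrant of the normal at `x` and the
direction of travel. -/
theorem Disk.exists_isGraphNear (D : Disk) {b : Set Plane} (hb : IsPreconnected b)
    (hbD : b ⊆ D.circle) {o x y : Plane} {ρ : ℝ} (hρ : 0 < ρ) (hx : x ∈ b) (hxo : dist x o ≤ ρ)
    (hy : y ∈ b) (hxy : 40 * ρ ≤ dist x y) :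
    20 * ρ ≤ D.radius ∧ ∃ c : Fin 4 × Bool,
      IsGraphNear D b o ρ ((c.1 : ℕ) * (π / 2)) (if c.2 then 1 else -1) := by
  have hrp := D.radius_pos
  have hr : 20 * ρ ≤ D.radius := by
    have h1 : dist x D.center = D.radius := hbD hx
    have h2 : dist y D.center = D.radius := hbD hy
    linarith [dist_triangle_right x y D.center]
  refine ⟨hr, ?_⟩
  obtain ⟨θ, hθ, rfl⟩ := D.exists_point_eq (hbD hx) (-(π / 4))
  obtain ⟨j, hj⟩ := exists_quadrant hθ
  obtain ⟨η, ⟨hη1, hη2⟩, rfl⟩ := D.exists_point_eq (hbD hy) θ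
  have hη1 : θ < η := by
    refine lt_of_le_of_ne hη1 ?_
    rintro rfl
    rw [dist_self] at hxy
    linarith
  have hT : 5 * ρ / D.radius * D.radius = 5 * ρ := div_mul_cancel₀ _ hrp.ne'
  rcases D.arc_subset_or hb hbD hη1 hη2 hx hy with h | h
  · refine ⟨(j, true), D.isGraphNear_of_arc hρ hr (by simp) hj hxo fun τ hτ => ?_⟩
    have h1 := D.dist_point_le θ η
    rw [abs_sub_comm, abs_of_pos (by linarith)] at h1
    refine h _ ⟨?_, ?_⟩
    · simp [hτ.1]
    · simp only [if_true, one_mul]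
      by_contra hcon
      nlinarith [hτ.2]
  · refine ⟨(j, false), D.isGraphNear_of_arc hρ hr (by simp) hj hxo fun τ hτ => ?_⟩
    have h1 := D.dist_point_le (θ + 2 * π) η
    rw [abs_of_pos (by linarith), D.point_add_two_pi] at h1
    rw [← D.point_add_two_pi]
    refine h _ ⟨?_, ?_⟩
    · simp only [Bool.false_eq_true, if_false, neg_mul, one_mul]
      by_contra hcon
      nlinarith [hτ.2]
    · simp [hτ.1]

/-- Moving inwards by t from a circle point changes the squared distance to the center by at most t²
- t · radius, which is negative because t ≤ 12ρ < radius. -/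
theorem Disk.mem_ball_of_above (D : Disk) {z w : Plane} {ρ ψ : ℝ} (hρ : 0 < ρ)
    (hr : 20 * ρ ≤ D.radius) (hz : z ∈ D.circle)
    (hn : D.radius / 2 ≤ (z 0 - D.center 0) * cos ψ + (z 1 - D.center 1) * sin ψ)
    (h1 : (z 1 - w 1) * cos ψ - (z 0 - w 0) * sin ψ = 0)
    (h2 : 0 < (z 0 - w 0) * cos ψ + (z 1 - w 1) * sin ψ)
    (h3 : (z 0 - w 0) * cos ψ + (z 1 - w 1) * sin ψ ≤ 12 * ρ) :
    w ∈ Metric.ball D.center D.radius := by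
  rw [D.mem_circle_iff] at hz
  rw [D.mem_ball_iff]
  set t := (z 0 - w 0) * cos ψ + (z 1 - w 1) * sin ψ with ht
  have hcs := sin_sq_add_cos_sq ψ
  have e0 : w 0 = z 0 - t * cos ψ := by
    rw [ht]
    linear_combination (z 0 - w 0) * hcs + sin ψ * h1
  have e1 : w 1 = z 1 - t * sin ψ := by
    rw [ht]
    linear_combination (z 1 - w 1) * hcs - cos ψ * h1
  have e : (w 0 - D.center 0) ^ 2 + (w 1 - D.center 1) ^ 2 = D.radius ^ 2 -
      2 * t * ((z 0 - D.center 0) * cos ψ + (z 1 - D.center 1) * sin ψ) + t ^ 2 := by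
    rw [e0, e1]
    linear_combination hz + t ^ 2 * hcs
  rw [e]
  nlinarith [mul_le_mul_of_nonneg_left hn h2.le]

theorem eq_of_above {C : Finset Disk} {D E : Disk} (hD : D ∈ C) (hE : E ∈ C) {o z w : Plane}
    {ρ ψ : ℝ} (hρ : 0 < ρ) (hrD : 20 * ρ ≤ D.radius) (hrE : 20 * ρ ≤ E.radius)
    (hz : z ∈ D.circle ∩ frontier (flower C)) (hw : w ∈ E.circle ∩ frontier (flower C))
    (hnz : D.radius / 2 ≤ (z 0 - D.center 0) * cos ψ + (z 1 - D.center 1) * sin ψ)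
    (hnw : E.radius / 2 ≤ (w 0 - E.center 0) * cos ψ + (w 1 - E.center 1) * sin ψ)
    (h1 : (z 1 - o 1) * cos ψ - (z 0 - o 0) * sin ψ = (w 1 - o 1) * cos ψ - (w 0 - o 0) * sin ψ)
    (hz6 : |(z 0 - o 0) * cos ψ + (z 1 - o 1) * sin ψ| ≤ 6 * ρ)
    (hw6 : |(w 0 - o 0) * cos ψ + (w 1 - o 1) * sin ψ| ≤ 6 * ρ) : z = w := by
  rw [abs_le] at hz6 hw6
  rcases lt_trichotomy ((z 0 - w 0) * cos ψ + (z 1 - w 1) * sin ψ) 0 with h | h | h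
  · exact absurd (E.mem_ball_of_above hρ hrE hw.1 hnw (by linarith) (by linarith) (by linarith))
      (notMem_ball_of_mem_frontier hE hz.2)
  · have hcs := sin_sq_add_cos_sq ψ
    have h1' : (z 1 - w 1) * cos ψ - (z 0 - w 0) * sin ψ = 0 := by linarith
    apply Plane.ext
    · linear_combination (-(z 0 - w 0)) * hcs - sin ψ * h1' + cos ψ * h
    · linear_combination (-(z 1 - w 1)) * hcs + cos ψ * h1' + sin ψ * h
  · exact absurd (D.mem_ball_of_above hρ hrD hz.1 hnz (by linarith) h (by linarith))
      (notMem_ball_of_mem_frontier hD hw.2)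

/-- Only boundedly many long boundary arcs of a union of disks meet a small disk. -/
theorem encard_long_arcs_le (C : Finset Disk) (o : Plane) {ρ : ℝ} (hρ : 0 < ρ) :
    {b ∈ boundaryArcs C | ∃ x ∈ b, dist x o ≤ ρ ∧ ∃ y ∈ b, 40 * ρ ≤ dist x y}.encard ≤ 8 := by
  set B := {b ∈ boundaryArcs C | ∃ x ∈ b, dist x o ≤ ρ ∧ ∃ y ∈ b, 40 * ρ ≤ dist x y} with hB
  have hex : ∀ b ∈ B, ∃ c : Fin 4 × Bool, ∃ D ∈ C, b ⊆ D.circle ∩ frontier (flower C) ∧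
      (∀ z ∈ b, b = connectedComponentIn (D.circle ∩ frontier (flower C)) z) ∧
      20 * ρ ≤ D.radius ∧
      IsGraphNear D b o ρ ((c.1 : ℕ) * (π / 2)) (if c.2 then 1 else -1) := by
    rintro b ⟨hb, x, hx, hxo, y, hy, hxy⟩
    obtain ⟨D, hD, hbD, hbc⟩ := exists_disk_of_mem_boundaryArcs hb
    obtain ⟨hr, c, hc⟩ := D.exists_isGraphNear (isPreconnected_of_mem_boundaryArcs hb)
      (hbD.trans Set.inter_subset_left) hρ hx hxo hy hxy
    exact ⟨c, D, hD, hbD, hbc, hr, hc⟩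
  choose! f hf using hex
  have hinj : Set.InjOn f B := by
    intro b hb b' hb' hbb
    obtain ⟨D, hD, hbD, hbc, hrD, hgD⟩ := hf b hb
    obtain ⟨E, hE, hbE, hbc', hrE, hgE⟩ := hf b' hb'
    rw [← hbb] at hgE
    -- Two arcs of the same class agree at every height of the strip. Three heights give three
    -- common points, hence the same circle and the same component.
    have common : ∀ h ∈ Set.Icc ρ (3 / 2 * ρ), ∃ z ∈ b ∩ b',
        (z 1 - o 1) * cos (((f b).1 : ℕ) * (π / 2)) - (z 0 - o 0) * sin (((f b).1 : ℕ) * (π / 2)) =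
          (if (f b).2 then 1 else -1) * h := by
      intro h hh
      obtain ⟨z, hz, hz1, hz2, hz3⟩ := hgD h hh
      obtain ⟨w, hw, hw1, hw2, hw3⟩ := hgE h hh
      obtain rfl := eq_of_above hD hE hρ hrD hrE (hbD hz) (hbE hw) hz3 hw3 (hz1.trans hw1.symm)
        hz2 hw2
      exact ⟨z, ⟨hz, hw⟩, hz1⟩
    obtain ⟨z1, hz1, e1⟩ := common ρ ⟨le_rfl, by linarith⟩
    obtain ⟨z2, hz2, e2⟩ := common (5 / 4 * ρ) ⟨by linarith, by linarith⟩
    obtain ⟨z3, hz3, e3⟩ := common (3 / 2 * ρ) ⟨by linarith, le_rfl⟩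
    obtain rfl : D = E := by
      refine Disk.eq_of_circle_three (x := z1) (y := z2) (z := z3) ?_ ?_ ?_ (hbD hz1.1).1
        (hbD hz2.1).1 (hbD hz3.1).1 (hbE hz1.2).1 (hbE hz2.2).1 (hbE hz3.2).1
      all_goals
        rintro rfl
        split_ifs at * <;> linarith
    rw [hbc z1 hz1.1, hbc' z1 hz1.2]
  rw [← hinj.encard_image]
  refine (Set.encard_le_encard (Set.subset_univ _)).trans ?_
  rw [Set.encard_univ, ENat.card_eq_coe_fintype_card]
  simp

/-! ### Vertices of a stabbed union, by inversion at the stabbing point. -/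

theorem cross_ne_zero_of_cocircular {u₁ v₁ u₂ v₂ u₃ v₃ Q : ℝ} (h₁ : u₁ ^ 2 + v₁ ^ 2 = Q)
    (h₂ : u₂ ^ 2 + v₂ ^ 2 = Q) (h₃ : u₃ ^ 2 + v₃ ^ 2 = Q) (h12 : (u₁, v₁) ≠ (u₂, v₂))
    (h13 : (u₁, v₁) ≠ (u₃, v₃)) (h23 : (u₂, v₂) ≠ (u₃, v₃)) :
    (u₂ - u₁) * (v₃ - v₁) - (v₂ - v₁) * (u₃ - u₁) ≠ 0 := by
  intro h
  have hd : 0 < (u₂ - u₁) ^ 2 + (v₂ - v₁) ^ 2 := by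
    by_contra hcon
    exact h12 (Prod.ext (by nlinarith [sq_nonneg (u₂ - u₁), sq_nonneg (v₂ - v₁)])
      (by nlinarith [sq_nonneg (u₂ - u₁), sq_nonneg (v₂ - v₁)]))
  set N := (u₂ - u₁) ^ 2 + (v₂ - v₁) ^ 2 with hN
  set μ := ((u₃ - u₁) * (u₂ - u₁) + (v₃ - v₁) * (v₂ - v₁)) / N with hμ
  have hμN : μ * N = (u₃ - u₁) * (u₂ - u₁) + (v₃ - v₁) * (v₂ - v₁) :=
    div_mul_cancel₀ _ hd.ne'
  have e0 : u₃ - u₁ = μ * (u₂ - u₁) := by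
    apply mul_left_cancel₀ hd.ne'
    linear_combination (-(u₂ - u₁)) * hμN + (u₃ - u₁) * hN - (v₂ - v₁) * h
  have e1 : v₃ - v₁ = μ * (v₂ - v₁) := by
    apply mul_left_cancel₀ hd.ne'
    linear_combination (-(v₂ - v₁)) * hμN + (v₃ - v₁) * hN + (u₂ - u₁) * h
  have hu : u₃ = u₁ + μ * (u₂ - u₁) := by linarith
  have hv : v₃ = v₁ + μ * (v₂ - v₁) := by linarith
  have hz : μ * (μ - 1) * N = 0 := by
    rw [hN]
    rw [hu, hv] at h₃
    linear_combination h₃ - h₁ - μ * (h₂ - h₁)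
  rcases mul_eq_zero.1 ((mul_eq_zero.1 hz).resolve_right hd.ne') with h0 | h0
  · rw [h0] at hu hv
    exact h13 (Prod.ext (by simp [hu]) (by simp [hv]))
  · have : μ = 1 := by linarith
    rw [this] at hu hv
    exact h23 (Prod.ext (by simp [hu]) (by simp [hv]))

/-- The coordinates are those of the circumcenter. If two were negative, the third would be 1 + |l₁|
+ |l₂|, while the triangle inequality bounds its absolute value by |l₁| + |l₂|. -/
theorem not_two_neg_barycentric {u₁ v₁ u₂ v₂ u₃ v₃ l₁ l₂ l₃ Q : ℝ} (hQ : 0 < Q)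
    (h₁ : u₁ ^ 2 + v₁ ^ 2 = Q) (h₂ : u₂ ^ 2 + v₂ ^ 2 = Q) (h₃ : u₃ ^ 2 + v₃ ^ 2 = Q)
    (hl : l₁ + l₂ + l₃ = 1) (hu : l₁ * u₁ + l₂ * u₂ + l₃ * u₃ = 0)
    (hv : l₁ * v₁ + l₂ * v₂ + l₃ * v₃ = 0) (n₁ : l₁ < 0) (n₂ : l₂ < 0) : False := by
  have hdot : u₁ * u₂ + v₁ * v₂ ≤ Q := by nlinarith [sq_nonneg (u₁ - u₂), sq_nonneg (v₁ - v₂)]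
  have e : l₃ ^ 2 * Q = l₁ ^ 2 * Q + l₂ ^ 2 * Q + 2 * (l₁ * l₂) * (u₁ * u₂ + v₁ * v₂) := by
    linear_combination (-l₃ ^ 2) * h₃ + l₁ ^ 2 * h₁ + l₂ ^ 2 * h₂ +
      (l₃ * u₃ - l₁ * u₁ - l₂ * u₂) * hu + (l₃ * v₃ - l₁ * v₁ - l₂ * v₂) * hv
  have h12 : 0 < l₁ * l₂ := mul_pos_of_neg_of_neg n₁ n₂
  have e2 : l₃ ^ 2 * Q ≤ (l₁ + l₂) ^ 2 * Q := by
    rw [e]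
    nlinarith [mul_le_mul_of_nonneg_left hdot h12.le]
  have e3 : l₃ ^ 2 ≤ (l₁ + l₂) ^ 2 := le_of_mul_le_mul_right e2 hQ
  have e4 : l₃ = 1 - (l₁ + l₂) := by linarith
  rw [e4] at e3
  nlinarith

/-- Three distinct points on a circle around the origin cannot each lie on a line that has the
other two on one closed side and the origin strictly on the other side. -/
theorem no_three_separating_lines {u v A B T : Fin 3 → ℝ} {Q : ℝ}
    (hQ : ∀ k, u k ^ 2 + v k ^ 2 = Q) (hne : ∀ k l, k ≠ l → (u k, v k) ≠ (u l, v l))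
    (hT : ∀ k, 0 < T k) (hge : ∀ k l, T k ≤ A k * u l + B k * v l)
    (heq : ∀ k, T k = A k * u k + B k * v k) : False := by
  have h01 := hne 0 1 (by decide)
  have h02 := hne 0 2 (by decide)
  have h12 := hne 1 2 (by decide)
  have hΔ := cross_ne_zero_of_cocircular (hQ 0) (hQ 1) (hQ 2) h01 h02 h12
  set Δ := (u 1 - u 0) * (v 2 - v 0) - (v 1 - v 0) * (u 2 - u 0) with hΔd
  have hQp : 0 < Q := by
    have h0 : 0 ≤ Q := hQ 0 ▸ by positivity
    refine lt_of_le_of_ne h0 ?_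
    rintro rfl
    have h1 : ∀ k, u k = 0 ∧ v k = 0 := fun k =>
      ⟨by nlinarith [hQ k, sq_nonneg (u k), sq_nonneg (v k)],
        by nlinarith [hQ k, sq_nonneg (u k), sq_nonneg (v k)]⟩
    exact h01 (by simp [h1])
  -- `a`, `b`, `c` are the barycentric coordinates of the origin, by Cramer's rule.
  obtain ⟨a, ha⟩ : ∃ a, a * Δ = u 1 * v 2 - v 1 * u 2 := ⟨_, div_mul_cancel₀ _ hΔ⟩
  obtain ⟨b, hb⟩ : ∃ b, b * Δ = u 2 * v 0 - v 2 * u 0 := ⟨_, div_mul_cancel₀ _ hΔ⟩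
  obtain ⟨c, hc⟩ : ∃ c, c * Δ = u 0 * v 1 - v 0 * u 1 := ⟨_, div_mul_cancel₀ _ hΔ⟩
  have hs : a + b + c = 1 := by
    apply mul_right_cancel₀ hΔ
    rw [hΔd] at *
    linear_combination ha + hb + hc
  have hu : a * u 0 + b * u 1 + c * u 2 = 0 := by
    apply mul_right_cancel₀ hΔ
    linear_combination u 0 * ha + u 1 * hb + u 2 * hc
  have hv : a * v 0 + b * v 1 + c * v 2 = 0 := by
    apply mul_right_cancel₀ hΔ
    linear_combination v 0 * ha + v 1 * hb + v 2 * hc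
  -- The `k`-th affine function is negative at the origin, zero at point `k` and nonnegative at the
  -- other two points, so one of their two coordinates is negative. Over all `k` this forces two
  -- negative coordinates.
  have key : ∀ k, a * (A k * u 0 + B k * v 0 - T k) + b * (A k * u 1 + B k * v 1 - T k) +
      c * (A k * u 2 + B k * v 2 - T k) < 0 := by
    intro k
    have : a * (A k * u 0 + B k * v 0 - T k) + b * (A k * u 1 + B k * v 1 - T k) +
      c * (A k * u 2 + B k * v 2 - T k) = - T k := by
      linear_combination A k * hu + B k * hv - T k * hs
    linarith [hT k]
  have k0 : b < 0 ∨ c < 0 := by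
    by_contra! hcon
    have h := key 0
    have e := heq 0
    nlinarith [mul_nonneg hcon.1 (sub_nonneg.2 (hge 0 1)),
      mul_nonneg hcon.2 (sub_nonneg.2 (hge 0 2))]
  have k1 : a < 0 ∨ c < 0 := by
    by_contra! hcon
    have h := key 1
    have e := heq 1
    nlinarith [mul_nonneg hcon.1 (sub_nonneg.2 (hge 1 0)),
      mul_nonneg hcon.2 (sub_nonneg.2 (hge 1 2))]
  have k2 : a < 0 ∨ b < 0 := by
    by_contra! hcon
    have h := key 2
    have e := heq 2
    nlinarith [mul_nonneg hcon.1 (sub_nonneg.2 (hge 2 0)),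
      mul_nonneg hcon.2 (sub_nonneg.2 (hge 2 1))]
  have f01 : ¬ (a < 0 ∧ b < 0) := fun h =>
    not_two_neg_barycentric hQp (hQ 0) (hQ 1) (hQ 2) hs hu hv h.1 h.2
  have f02 : ¬ (a < 0 ∧ c < 0) := fun h =>
    not_two_neg_barycentric (l₃ := b) hQp (hQ 0) (hQ 2) (hQ 1) (by linarith) (by linarith) (by linarith)
      h.1 h.2
  have f12 : ¬ (b < 0 ∧ c < 0) := fun h =>
    not_two_neg_barycentric (l₃ := a) hQp (hQ 1) (hQ 2) (hQ 0) (by linarith) (by linarith) (by linarith)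
      h.1 h.2
  tauto

/-- The value at `(u, v)`, the image of a point under the inversion centered at `p`, of the
function that is at most `1` exactly when that point is not inside `D`. -/
def Disk.invPower (D : Disk) (p : Plane) (y : ℝ × ℝ) : ℝ :=
  (D.radius ^ 2 - (D.center 0 - p 0) ^ 2 - (D.center 1 - p 1) ^ 2) * (y.1 ^ 2 + y.2 ^ 2) +
    2 * (y.1 * (D.center 0 - p 0) + y.2 * (D.center 1 - p 1))

/-- The power of `p` with respect to `D`, negated. -/
def Disk.slack (D : Disk) (p : Plane) : ℝ :=
  D.radius ^ 2 - (D.center 0 - p 0) ^ 2 - (D.center 1 - p 1) ^ 2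

theorem Disk.slack_nonneg {D : Disk} {p : Plane} (h : p ∈ D.toSet) : 0 ≤ D.slack p := by
  rw [D.mem_toSet_iff] at h
  unfold slack
  nlinarith

theorem Disk.ext' {D E : Disk} (h0 : D.center 0 = E.center 0) (h1 : D.center 1 = E.center 1)
    (h : D.radius = E.radius) : D = E := by
  have := Plane.ext h0 h1
  cases D
  cases E
  simp_all

/-- Up to positive factors, the quantity in `hcon` is the squared distance of the centers of the two
inverted disks plus the difference of their squared radii, r/s and r'/t. Both terms are nonnegative,
hence zero. -/
theorem eq_of_center_side_nonpos {a b a' b' r r' s t : ℝ} (hr : 0 < r) (hr' : 0 < r') (hs : 0 < s)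
    (hs' : s = r ^ 2 - a ^ 2 - b ^ 2) (ht' : t = r' ^ 2 - a' ^ 2 - b' ^ 2) (hrk : r' * s ≤ r * t)
    (hcon : s * (t - s) + 2 * t * (a ^ 2 + b ^ 2) - 2 * s * (a * a' + b * b') ≤ 0) :
    a = a' ∧ b = b' ∧ r = r' := by
  have htp : 0 < t := by
    have h1 : 0 < r * t := lt_of_lt_of_le (by positivity) hrk
    exact pos_of_mul_pos_right h1 hr.le
  have e : t * (s * (t - s) + 2 * t * (a ^ 2 + b ^ 2) - 2 * s * (a * a' + b * b')) =
      (t * a - s * a') ^ 2 + (t * b - s * b') ^ 2 + ((r * t) ^ 2 - (r' * s) ^ 2) := by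
    linear_combination t ^ 2 * hs' - s ^ 2 * ht'
  have hsq : (r' * s) ^ 2 ≤ (r * t) ^ 2 := pow_le_pow_left₀ (by positivity) hrk 2
  have hcon := mul_nonpos_of_nonneg_of_nonpos htp.le hcon
  rw [e] at hcon
  have q0 := sq_nonneg (t * a - s * a')
  have q1 := sq_nonneg (t * b - s * b')
  have z0 : t * a - s * a' = 0 := pow_eq_zero_iff two_ne_zero |>.1 (by linarith)
  have z1 : t * b - s * b' = 0 := pow_eq_zero_iff two_ne_zero |>.1 (by linarith)
  have z2 : (r * t) ^ 2 = (r' * s) ^ 2 := by linarith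
  have z2 : r * t = r' * s := (pow_left_inj₀ (by positivity) (by positivity) two_ne_zero).1 z2
  have hts : t = s := by
    have h0 : s * t * (t - s) = 0 := by
      linear_combination t ^ 2 * hs' - s ^ 2 * ht' +
        (r * t + r' * s) * z2 - (t * a + s * a') * z0 - (t * b + s * b') * z1
    have h1 := (mul_eq_zero.1 h0).resolve_left (by positivity)
    linarith
  rw [hts] at z0 z1 z2
  exact ⟨mul_left_cancel₀ hs.ne' (by linarith), mul_left_cancel₀ hs.ne' (by linarith),
    mul_right_cancel₀ hs.ne' z2⟩

/-- The image of `D` is a disk of radius `D.radius / D.slack p`. Line `k` is the radical axis of the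
images of `D` and `E k`. By `hr` the image of `E k` is no larger, so the center of the image of `D`
lies strictly beyond that line, and `no_three_separating_lines` applies in coordinates around this
center, scaled by the slack. -/
theorem Disk.not_three_of_slack_pos {D : Disk} {p : Plane} (hs : 0 < D.slack p) {E : Fin 3 → Disk}
    {y : Fin 3 → ℝ × ℝ} (hy : Function.Injective y) (hED : ∀ k, E k ≠ D)
    (hD : ∀ k, D.invPower p (y k) = 1) (hE : ∀ k, (E k).invPower p (y k) = 1)
    (hEl : ∀ k l, (E k).invPower p (y l) ≤ 1)
    (hr : ∀ k, (E k).radius * D.slack p ≤ D.radius * (E k).slack p) : False := by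
  have hrp := D.radius_pos
  set s := D.slack p with hsd
  set a := D.center 0 - p 0 with ha
  set b := D.center 1 - p 1 with hb
  have hs' : s = D.radius ^ 2 - a ^ 2 - b ^ 2 := rfl
  have hDi : ∀ k, s * ((y k).1 ^ 2 + (y k).2 ^ 2) + 2 * ((y k).1 * a + (y k).2 * b) = 1 := hD
  refine no_three_separating_lines (u := fun k => s * (y k).1 + a) (v := fun k => s * (y k).2 + b)
    (A := fun k => 2 * ((E k).slack p * a - s * ((E k).center 0 - p 0)))
    (B := fun k => 2 * ((E k).slack p * b - s * ((E k).center 1 - p 1)))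
    (T := fun k => s * ((E k).slack p - s) + 2 * (E k).slack p * (a ^ 2 + b ^ 2) -
      2 * s * (a * ((E k).center 0 - p 0) + b * ((E k).center 1 - p 1)))
    (Q := D.radius ^ 2) ?_ ?_ ?_ ?_ ?_
  · intro k
    linear_combination s * hDi k + hs'
  · intro k l hkl h
    apply hkl
    apply hy
    simp only [Prod.mk.injEq, add_left_inj] at h
    exact Prod.ext (mul_left_cancel₀ hs.ne' h.1) (mul_left_cancel₀ hs.ne' h.2)
  · intro k
    have hrk := hr k
    have hEr := (E k).radius_pos
    by_contra hcon
    obtain ⟨h0, h1, h2⟩ := eq_of_center_side_nonpos hrp hEr hs hs' rfl hrk (not_lt.1 hcon)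
    exact hED k (Disk.ext' (by linarith) (by linarith) h2.symm)
  · intro k l
    have h1 : (E k).slack p * ((y l).1 ^ 2 + (y l).2 ^ 2) +
      2 * ((y l).1 * ((E k).center 0 - p 0) + (y l).2 * ((E k).center 1 - p 1)) ≤ 1 := hEl k l
    have h2 := hDi l
    have h3 := mul_le_mul_of_nonneg_left h1 (mul_pos hs hs).le
    simp only
    linear_combination h3 - s * (E k).slack p * h2
  · intro k
    have h1 : (E k).slack p * ((y k).1 ^ 2 + (y k).2 ^ 2) +
      2 * ((y k).1 * ((E k).center 0 - p 0) + (y k).2 * ((E k).center 1 - p 1)) = 1 := hE k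
    have h2 := hDi k
    simp only
    linear_combination s ^ 2 * h1 - s * (E k).slack p * h2

/-- A convex quadratic that is at most 1 at the ends of a segment and equal to 1 inside it has no
quadratic part and equals 1 on the whole segment; the line then determines its linear part. -/
theorem eq_of_line_between {y0 y1 z0 z1 a b a' b' t μ : ℝ} (hEs : 0 ≤ t) (hμ0 : 0 < μ) (hμ1 : μ < 1)
    (hyz : (y0, y1) ≠ (z0, z1)) (hDy : 2 * (y0 * a + y1 * b) = 1)
    (hDz : 2 * (z0 * a + z1 * b) = 1) (hy : t * (y0 ^ 2 + y1 ^ 2) + 2 * (y0 * a' + y1 * b') ≤ 1)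
    (hz : t * (z0 ^ 2 + z1 ^ 2) + 2 * (z0 * a' + z1 * b') ≤ 1)
    (hm : t * (((1 - μ) * y0 + μ * z0) ^ 2 + ((1 - μ) * y1 + μ * z1) ^ 2) +
      2 * (((1 - μ) * y0 + μ * z0) * a' + ((1 - μ) * y1 + μ * z1) * b') = 1) :
    a' = a ∧ b' = b ∧ t = 0 := by
  have hN : 0 < (y0 - z0) ^ 2 + (y1 - z1) ^ 2 := by
    by_contra hcon
    exact hyz (Prod.ext (by nlinarith [sq_nonneg (y0 - z0), sq_nonneg (y1 - z1)])
      (by nlinarith [sq_nonneg (y0 - z0), sq_nonneg (y1 - z1)]))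
  have e : t * (μ * (1 - μ)) * ((y0 - z0) ^ 2 + (y1 - z1) ^ 2) +
      (1 - μ) * (1 - (t * (y0 ^ 2 + y1 ^ 2) + 2 * (y0 * a' + y1 * b'))) +
      μ * (1 - (t * (z0 ^ 2 + z1 ^ 2) + 2 * (z0 * a' + z1 * b'))) = 0 := by
    linear_combination -hm
  have hμ2 : 0 < 1 - μ := by linarith
  have n1 := mul_nonneg (mul_nonneg hEs (mul_pos hμ0 hμ2).le) hN.le
  have n2 := mul_nonneg hμ2.le (sub_nonneg.2 hy)
  have n3 := mul_nonneg hμ0.le (sub_nonneg.2 hz)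
  have t0 : t = 0 := by
    have : t * (μ * (1 - μ)) * ((y0 - z0) ^ 2 + (y1 - z1) ^ 2) = 0 := by linarith
    have := (mul_eq_zero.1 this).resolve_right hN.ne'
    exact (mul_eq_zero.1 this).resolve_right (mul_pos hμ0 hμ2).ne'
  rw [t0] at n2 n3 e hy hz
  have ey : 2 * (y0 * a' + y1 * b') = 1 := by
    have : (1 - μ) * (1 - (0 * (y0 ^ 2 + y1 ^ 2) + 2 * (y0 * a' + y1 * b'))) = 0 := by linarith
    have := (mul_eq_zero.1 this).resolve_left hμ2.ne'
    linarith
  have ez : 2 * (z0 * a' + z1 * b') = 1 := by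
    have : μ * (1 - (0 * (z0 ^ 2 + z1 ^ 2) + 2 * (z0 * a' + z1 * b'))) = 0 := by linarith
    have := (mul_eq_zero.1 this).resolve_left hμ0.ne'
    linarith
  have hcr : a' * b - b' * a = 0 := by
    have h0 : (y0 - z0) * (a' * b - b' * a) = 0 := by
      linear_combination b / 2 * (ey - ez) - b' / 2 * (hDy - hDz)
    have h1 : (y1 - z1) * (a' * b - b' * a) = 0 := by
      linear_combination a' / 2 * (hDy - hDz) - a / 2 * (ey - ez)
    rcases mul_eq_zero.1 h0 with h | h
    · rcases mul_eq_zero.1 h1 with h' | h'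
      · rw [h, h'] at hN
        norm_num at hN
      · exact h'
    · exact h
  have c0 : a' = a := by linear_combination a * ey - a' * hDy + 2 * y1 * hcr
  have c1 : b' = b := by linear_combination b * ey - b' * hDy - 2 * y0 * hcr
  exact ⟨c0, c1, t0⟩

theorem Disk.not_between_of_slack_zero {D E : Disk} {p : Plane} (hs : D.slack p = 0)
    (hEs : 0 ≤ E.slack p) {y z : ℝ × ℝ} {μ : ℝ} (hμ0 : 0 < μ) (hμ1 : μ < 1) (hyz : y ≠ z)
    (hED : E ≠ D) (hDy : D.invPower p y = 1) (hDz : D.invPower p z = 1)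
    (hy : E.invPower p y ≤ 1) (hz : E.invPower p z ≤ 1)
    (hm : E.invPower p ((1 - μ) * y.1 + μ * z.1, (1 - μ) * y.2 + μ * z.2) = 1) : False := by
  obtain ⟨y0, y1⟩ := y
  obtain ⟨z0, z1⟩ := z
  have hDr := D.radius_pos
  have hEr := E.radius_pos
  set a := D.center 0 - p 0 with ha
  set b := D.center 1 - p 1 with hb
  set a' := E.center 0 - p 0 with ha'
  set b' := E.center 1 - p 1 with hb'
  set t := E.slack p with ht
  have hs' : D.radius ^ 2 - a ^ 2 - b ^ 2 = 0 := hs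
  have ht' : t = E.radius ^ 2 - a' ^ 2 - b' ^ 2 := rfl
  change (D.radius ^ 2 - a ^ 2 - b ^ 2) * (y0 ^ 2 + y1 ^ 2) + 2 * (y0 * a + y1 * b) = 1 at hDy
  change (D.radius ^ 2 - a ^ 2 - b ^ 2) * (z0 ^ 2 + z1 ^ 2) + 2 * (z0 * a + z1 * b) = 1 at hDz
  change t * (y0 ^ 2 + y1 ^ 2) + 2 * (y0 * a' + y1 * b') ≤ 1 at hy
  change t * (z0 ^ 2 + z1 ^ 2) + 2 * (z0 * a' + z1 * b') ≤ 1 at hz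
  change t * (((1 - μ) * y0 + μ * z0) ^ 2 + ((1 - μ) * y1 + μ * z1) ^ 2) +
    2 * (((1 - μ) * y0 + μ * z0) * a' + ((1 - μ) * y1 + μ * z1) * b') = 1 at hm
  rw [hs', zero_mul, zero_add] at hDy hDz
  obtain ⟨c0, c1, t0⟩ := eq_of_line_between hEs hμ0 hμ1 hyz hDy hDz hy hz hm
  apply hED
  refine Disk.ext' (by linarith) (by linarith) ?_
  rw [← pow_left_inj₀ hEr.le hDr.le two_ne_zero]
  rw [c0, c1, t0] at ht'
  linarith

/-- Here `p` is on the circle of `D`, whose image is a line with coordinate `τ`. The middle one of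
the three points contradicts `Disk.not_between_of_slack_zero`. -/
theorem Disk.not_three_of_slack_zero {D : Disk} {p : Plane} (hs : D.slack p = 0) {E : Fin 3 → Disk}
    {y : Fin 3 → ℝ × ℝ} (hy : Function.Injective y) (hED : ∀ k, E k ≠ D)
    (hEs : ∀ k, 0 ≤ (E k).slack p)
    (hD : ∀ k, D.invPower p (y k) = 1) (hE : ∀ k, (E k).invPower p (y k) = 1)
    (hEl : ∀ k l, (E k).invPower p (y l) ≤ 1) : False := by
  have hDr := D.radius_pos
  set a := D.center 0 - p 0 with ha
  set b := D.center 1 - p 1 with hb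
  have hs' : D.radius ^ 2 - a ^ 2 - b ^ 2 = 0 := hs
  have hDi : ∀ k, 2 * ((y k).1 * a + (y k).2 * b) = 1 := by
    intro k
    have : (D.radius ^ 2 - a ^ 2 - b ^ 2) * ((y k).1 ^ 2 + (y k).2 ^ 2) +
      2 * ((y k).1 * a + (y k).2 * b) = 1 := hD k
    rwa [hs', zero_mul, zero_add] at this
  have hR : 0 < a ^ 2 + b ^ 2 := by nlinarith
  let τ : Fin 3 → ℝ := fun k => a * (y k).2 - b * (y k).1
  have hτ0 : ∀ k, (a ^ 2 + b ^ 2) * (y k).1 = a / 2 - b * τ k := by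
    intro k
    simp only [τ]
    linear_combination a / 2 * hDi k
  have hτ1 : ∀ k, (a ^ 2 + b ^ 2) * (y k).2 = b / 2 + a * τ k := by
    intro k
    simp only [τ]
    linear_combination b / 2 * hDi k
  have hτ : ∀ k l, τ k = τ l → k = l := by
    intro k l h
    apply hy
    apply Prod.ext
    · apply mul_left_cancel₀ hR.ne'
      rw [hτ0, hτ0, h]
    · apply mul_left_cancel₀ hR.ne'
      rw [hτ1, hτ1, h]
  have main : ∀ i j k, τ i < τ j → τ j < τ k → False := by
    intro i j k hij hjk
    have hik : 0 < τ k - τ i := by linarith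
    set μ := (τ j - τ i) / (τ k - τ i) with hμ
    have hμe : μ * (τ k - τ i) = τ j - τ i := div_mul_cancel₀ _ hik.ne'
    have hμ0 : 0 < μ := div_pos (by linarith) hik
    have hμ1 : μ < 1 := (div_lt_one hik).2 (by linarith)
    have hne : y i ≠ y k := fun h => by
      have := hy h
      subst this
      simp at hik
    refine Disk.not_between_of_slack_zero hs (hEs j) hμ0 hμ1 hne (hED j) (hD i) (hD k) (hEl j i)
      (hEl j k) ?_
    have : ((1 - μ) * (y i).1 + μ * (y k).1, (1 - μ) * (y i).2 + μ * (y k).2) = y j := by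
      apply Prod.ext
      · apply mul_left_cancel₀ hR.ne'
        linear_combination (1 - μ) * hτ0 i + μ * hτ0 k - hτ0 j - b * hμe
      · apply mul_left_cancel₀ hR.ne'
        linear_combination (1 - μ) * hτ1 i + μ * hτ1 k - hτ1 j + a * hμe
    rw [this]
    exact hE j
  have h01 : τ 0 ≠ τ 1 := fun h => absurd (hτ _ _ h) (by decide)
  have h02 : τ 0 ≠ τ 2 := fun h => absurd (hτ _ _ h) (by decide)
  have h12 : τ 1 ≠ τ 2 := fun h => absurd (hτ _ _ h) (by decide)
  rcases lt_or_gt_of_ne h01 with h | h <;> rcases lt_or_gt_of_ne h02 with h' | h' <;>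
    rcases lt_or_gt_of_ne h12 with h'' | h''
  all_goals first
    | exact main _ _ _ h h''
    | exact main _ _ _ h' h''
    | exact main _ _ _ h h'
    | exact main _ _ _ h' h
    | exact main _ _ _ h'' h
    | exact main _ _ _ h'' h'

/-- Inversion centered at `p`, in coordinates centered at `p`. -/
noncomputable def inversionAt (p q : Plane) : ℝ × ℝ :=
  ((q 0 - p 0) / dist q p ^ 2, (q 1 - p 1) / dist q p ^ 2)

theorem inversionAt_sq_add {p q : Plane} (h : q ≠ p) :
    (inversionAt p q).1 ^ 2 + (inversionAt p q).2 ^ 2 = 1 / dist q p ^ 2 := by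
  have hd : dist q p ^ 2 ≠ 0 := pow_ne_zero _ (dist_ne_zero.2 h)
  have e := Plane.dist_sq q p
  simp only [inversionAt]
  rw [div_pow, div_pow, ← add_div, ← e]
  field_simp

theorem inversionAt_injOn (p : Plane) : Set.InjOn (inversionAt p) {p}ᶜ := by
  intro q hq q' hq' h
  have hd : dist q p ^ 2 ≠ 0 := pow_ne_zero _ (dist_ne_zero.2 hq)
  have e := inversionAt_sq_add hq
  rw [h, inversionAt_sq_add hq', one_div, one_div, inv_inj] at e
  simp only [inversionAt, Prod.mk.injEq, e] at h
  rw [div_left_inj' hd, div_left_inj' hd] at h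
  exact Plane.ext (by linarith [h.1]) (by linarith [h.2])

theorem Disk.invPower_inversionAt (D : Disk) {p q : Plane} (h : q ≠ p) :
    D.invPower p (inversionAt p q) = 1 - ((q 0 - D.center 0) ^ 2 + (q 1 - D.center 1) ^ 2 -
      D.radius ^ 2) / dist q p ^ 2 := by
  have hd : dist q p ^ 2 ≠ 0 := pow_ne_zero _ (dist_ne_zero.2 h)
  have e := Plane.dist_sq q p
  rw [invPower, inversionAt_sq_add h]
  simp only [inversionAt]
  generalize dist q p ^ 2 = N at *
  subst e
  field_simp
  ring

theorem Disk.invPower_eq_one (D : Disk) {p q : Plane} (h : q ≠ p) (hq : q ∈ D.circle) :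
    D.invPower p (inversionAt p q) = 1 := by
  rw [D.invPower_inversionAt h, (D.mem_circle_iff q).1 hq]
  simp

theorem Disk.invPower_le_one (D : Disk) {p q : Plane} (h : q ≠ p)
    (hq : q ∉ Metric.ball D.center D.radius) : D.invPower p (inversionAt p q) ≤ 1 := by
  rw [D.invPower_inversionAt h, sub_le_self_iff]
  rw [D.mem_ball_iff, not_lt] at hq
  exact div_nonneg (by linarith) (by positivity)

/-- The points on the boundary of the union of the interiors of the disks of `C` that lie on the
boundary circles of two of the disks. -/
def crossings (C : Finset Disk) : Set Plane :=
  {q | (∀ D ∈ C, q ∉ Metric.ball D.center D.radius) ∧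
    ∃ D ∈ C, ∃ E ∈ C, E ≠ D ∧ q ∈ D.circle ∧ q ∈ E.circle}

/-- The last inequality compares the image radii: it counts only crossings with disks whose inverted
image is no larger than that of `D`. -/
theorem encard_crossings_on_circle_le {C : Finset Disk} {p : Plane} (hp : ∀ D ∈ C, p ∈ D.toSet)
    {D : Disk} (hD : D ∈ C) :
    {q | q ≠ p ∧ (∀ E ∈ C, q ∉ Metric.ball E.center E.radius) ∧ q ∈ D.circle ∧
      ∃ E ∈ C, E ≠ D ∧ q ∈ E.circle ∧
        E.radius * D.slack p ≤ D.radius * E.slack p}.encard ≤ 2 := by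
  apply Set.encard_le_two_of
  intro x hx y hy z hz hxy hxz hyz
  let q : Fin 3 → Plane := ![x, y, z]
  have hq : ∀ k, q k ≠ p ∧ (∀ E ∈ C, q k ∉ Metric.ball E.center E.radius) ∧ q k ∈ D.circle ∧
      ∃ E ∈ C, E ≠ D ∧ q k ∈ E.circle ∧ E.radius * D.slack p ≤ D.radius * E.slack p := by
    intro k
    fin_cases k
    · exact hx
    · exact hy
    · exact hz
  have hinj : Function.Injective q := by
    intro k l h
    fin_cases k <;> fin_cases l <;> simp_all [q]
  choose hqp hqb hqD E hEC hED hEq hEr using hq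
  have hyinj : Function.Injective fun k => inversionAt p (q k) := fun k l h =>
    hinj (inversionAt_injOn p (hqp k) (hqp l) h)
  rcases (Disk.slack_nonneg (hp D hD)).lt_or_eq with hs | hs
  · exact Disk.not_three_of_slack_pos hs hyinj hED (fun k => D.invPower_eq_one (hqp k) (hqD k))
      (fun k => (E k).invPower_eq_one (hqp k) (hEq k))
      (fun k l => (E k).invPower_le_one (hqp l) (hqb l _ (hEC k))) hEr
  · exact Disk.not_three_of_slack_zero hs.symm hyinj hED
      (fun k => Disk.slack_nonneg (hp _ (hEC k)))
      (fun k => D.invPower_eq_one (hqp k) (hqD k))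
      (fun k => (E k).invPower_eq_one (hqp k) (hEq k))
      (fun k l => (E k).invPower_le_one (hqp l) (hqb l _ (hEC k)))

/-! ### Linear bounds for vertices and boundary arcs. -/

theorem Finset.encard_biUnion_le {α β : Type*} (s : Finset α) (f : α → Set β) :
    (⋃ i ∈ s, f i).encard ≤ ∑ i ∈ s, (f i).encard := by
  classical
  induction s using Finset.induction_on with
  | empty => simp
  | insert a s ha ih =>
    rw [Finset.set_biUnion_insert, Finset.sum_insert ha]
    exact (Set.encard_union_le _ _).trans (add_le_add le_rfl ih)

theorem Finset.encard_biUnion_le_mul {α β : Type*} (s : Finset α) (f : α → Set β) {k : ℕ∞}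
    (h : ∀ i ∈ s, (f i).encard ≤ k) : (⋃ i ∈ s, f i).encard ≤ s.card * k := by
  refine (s.encard_biUnion_le f).trans ((Finset.sum_le_sum h).trans ?_)
  simp

theorem Set.encard_biUnion_le_mul {α β : Type*} {s : Set α} (f : α → Set β) {m k : ℕ∞}
    (hs : s.Finite) (hm : s.encard ≤ m) (h : ∀ i ∈ s, (f i).encard ≤ k) :
    (⋃ i ∈ s, f i).encard ≤ m * k := by
  have h1 := hs.toFinset.encard_biUnion_le_mul f (k := k) (fun i hi => h i (hs.mem_toFinset.1 hi))
  simp only [hs.mem_toFinset] at h1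
  refine h1.trans (mul_le_mul_left ?_ _)
  rwa [← hs.encard_eq_coe_toFinset_card]

/-- A union of `n` disks with a common point has linearly many vertices. -/
theorem encard_crossings_le {C : Finset Disk} (hC : IsStabbedClique C) :
    (crossings C).encard ≤ C.card * 3 := by
  obtain ⟨p, hp⟩ := hC
  rcases C.eq_empty_or_nonempty with rfl | hne
  · simp [crossings]
  have hsub : crossings C ⊆ {p} ∪ ⋃ D ∈ C,
      {q | q ≠ p ∧ (∀ E ∈ C, q ∉ Metric.ball E.center E.radius) ∧ q ∈ D.circle ∧
      ∃ E ∈ C, E ≠ D ∧ q ∈ E.circle ∧ E.radius * D.slack p ≤ D.radius * E.slack p} := by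
    rintro q ⟨hq, D, hD, E, hE, hED, hqD, hqE⟩
    by_cases hqp : q = p
    · exact Or.inl hqp
    · right
      simp only [Set.mem_iUnion]
      -- Charge the crossing to the disk with the larger image. The point `p`, where inversion is
      -- undefined, costs one more: 1 + 2n ≤ 3n.
      rcases le_total (E.radius * D.slack p) (D.radius * E.slack p) with h | h
      · exact ⟨D, hD, hqp, hq, hqD, E, hE, hED, hqE, h⟩
      · exact ⟨E, hE, hqp, hq, hqE, D, hD, hED.symm, hqD, h⟩
  refine (Set.encard_le_encard hsub).trans ((Set.encard_union_le _ _).trans ?_)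
  have h1 := C.encard_biUnion_le_mul _ (fun D hD => encard_crossings_on_circle_le hp hD)
  rw [Set.encard_singleton]
  refine (add_le_add le_rfl h1).trans ?_
  have : 0 < C.card := hne.card_pos
  norm_cast
  omega

theorem mem_crossings_of_mem_frontier {C : Finset Disk} {D E : Disk} {q : Plane} (hD : D ∈ C)
    (hE : E ∈ C) (hED : E ≠ D) (hq : q ∈ D.circle ∩ frontier (flower C)) (hqE : q ∈ E.toSet) :
    q ∈ crossings C := by
  refine ⟨fun F hF => notMem_ball_of_mem_frontier hF hq.2, D, hD, E, hE, hED, hq.1, ?_⟩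
  have h := notMem_ball_of_mem_frontier hE hq.2
  rw [Metric.mem_ball, not_lt] at h
  exact le_antisymm hqE h

/-- Near a boundary point of the flower that lies in only one disk, the circle of this disk is
part of the boundary of the flower. -/
theorem exists_nhds_circle_subset_frontier {C : Finset Disk} {D : Disk} {q : Plane} (hD : D ∈ C)
    (hq : ∀ E ∈ C, E ≠ D → q ∉ E.toSet) :
    ∃ W : Set Plane, IsOpen W ∧ q ∈ W ∧ W ∩ D.circle ⊆ frontier (flower C) := by
  classical
  refine ⟨(flower (C.erase D))ᶜ, (isClosed_flower _).isOpen_compl, ?_, ?_⟩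
  · rw [Set.mem_compl_iff, flower_def]
    rintro ⟨E, hE, hqE⟩
    exact hq E (Finset.mem_of_mem_erase hE) (Finset.ne_of_mem_erase hE) hqE
  · rintro x ⟨hxW, hxD⟩
    refine ⟨subset_closure ((flower_def C x).2 ⟨D, hD, D.circle_subset hxD⟩), fun hx => ?_⟩
    have h1 : x ∈ interior D.toSet := by
      refine interior_mono ?_ (show x ∈ interior (flower C ∩ (flower (C.erase D))ᶜ) from ?_)
      · rintro y ⟨hy, hyW⟩
        obtain ⟨E, hE, hyE⟩ := (flower_def C y).1 hy
        by_cases hED : E = D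
        · exact hED ▸ hyE
        · exact absurd ((flower_def _ y).2 ⟨E, Finset.mem_erase.2 ⟨hED, hE⟩, hyE⟩) hyW
      · rw [interior_inter, (isClosed_flower _).isOpen_compl.interior_eq]
        exact ⟨hx, hxW⟩
    rw [Disk.toSet, interior_closedBall _ D.radius_pos.ne', Metric.mem_ball] at h1
    exact h1.ne hxD

/-- An arc without crossings is closed and also open in its circle, so it is the whole circle. -/
theorem eq_circle_or_exists_crossing {C : Finset Disk} {b : Set Plane} (hb : b ∈ boundaryArcs C) :
    (∃ D ∈ C, D.circle = b) ∨ ∃ q ∈ crossings C, q ∈ b := by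
  by_contra! hcon
  obtain ⟨hcon1, hcon2⟩ := hcon
  obtain ⟨D, hD, hbS, hbc⟩ := exists_disk_of_mem_boundaryArcs hb
  obtain ⟨x, hx⟩ := hb.1.nonempty
  refine hcon1 D hD ?_
  have hclosed : IsClosed b := by
    refine isClosed_of_closure_subset ?_
    conv_rhs => rw [hbc x hx]
    exact (isPreconnected_of_mem_boundaryArcs hb).closure.subset_connectedComponentIn
      (subset_closure hx) (closure_minimal hbS (Metric.isClosed_sphere.inter isClosed_frontier))
  have hopen : IsOpen (D.point ⁻¹' b) := by
    rw [Metric.isOpen_iff]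
    intro θ hθ
    have hq : ∀ E ∈ C, E ≠ D → D.point θ ∉ E.toSet := fun E hE hED hqE =>
      hcon2 _ (mem_crossings_of_mem_frontier hD hE hED (hbS hθ) hqE) hθ
    obtain ⟨W, hWo, hqW, hW⟩ := exists_nhds_circle_subset_frontier hD hq
    obtain ⟨ε, hε, hεW⟩ := Metric.isOpen_iff.1 (hWo.preimage D.continuous_point) θ hqW
    refine ⟨ε, hε, fun η hη => ?_⟩
    rw [Set.mem_preimage, hbc _ hθ]
    have hpre : IsPreconnected (D.point '' Metric.ball θ ε) := by
      rw [Real.ball_eq_Ioo]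
      exact isPreconnected_Ioo.image _ D.continuous_point.continuousOn
    refine hpre.subset_connectedComponentIn
      (Set.mem_image_of_mem _ (Metric.mem_ball_self hε)) ?_ (Set.mem_image_of_mem _ hη)
    rintro _ ⟨ζ, hζ, rfl⟩
    exact ⟨D.point_mem_circle ζ, hW ⟨hεW hζ, D.point_mem_circle ζ⟩⟩
  have huniv : D.point ⁻¹' b = Set.univ := by
    refine IsClopen.eq_univ ⟨hclosed.preimage D.continuous_point, hopen⟩ ?_
    obtain ⟨θ, -, rfl⟩ := D.exists_point_eq (hbS hx).1 0
    exact ⟨θ, hx⟩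
  apply Set.Subset.antisymm _ fun y hy => (hbS hy).1
  intro y hy
  obtain ⟨θ, -, rfl⟩ := D.exists_point_eq hy 0
  exact huniv.ge (Set.mem_univ θ)

/-- Nine arcs through `q` would all be long relative to a sufficiently small radius around `q`,
against `encard_long_arcs_le`. -/
theorem encard_arcs_through_le (C : Finset Disk) (q : Plane) :
    {b ∈ boundaryArcs C | q ∈ b}.encard ≤ 8 := by
  by_contra hcon
  have h9 : (8 + 1 : ℕ∞) ≤ {b ∈ boundaryArcs C | q ∈ b}.encard :=
    Order.add_one_le_of_lt (not_le.1 hcon)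
  obtain ⟨T, hT, hTc⟩ := Set.exists_subset_encard_eq h9
  have hfin : T.Finite := by
    rw [← Set.encard_lt_top_iff, hTc]
    exact ENat.natCast_lt_top 9
  have hy : ∀ b ∈ T, ∃ y ∈ b, 0 < dist q y := by
    intro b hb
    obtain ⟨y, hy, hne⟩ := (hT hb).1.1.exists_ne q
    exact ⟨y, hy, dist_pos.2 hne.symm⟩
  choose! y hyb hyd using hy
  have hev : ∀ᶠ ρ in nhdsWithin (0 : ℝ) (Set.Ioi 0), 0 < ρ ∧ ∀ b ∈ T, 40 * ρ ≤ dist q (y b) := by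
    refine (eventually_mem_nhdsWithin).and ((Filter.eventually_all_finite hfin).2 fun b hb => ?_)
    refine nhdsWithin_le_nhds ?_
    have hc : Filter.Tendsto (fun ρ : ℝ => 40 * ρ) (nhds 0) (nhds (40 * 0)) :=
      (continuous_const.mul continuous_id).tendsto 0
    rw [mul_zero] at hc
    exact (hc.eventually (gt_mem_nhds (hyd b hb))).mono fun _ h => h.le
  obtain ⟨ρ, hρ, hall⟩ := hev.exists
  have hle := Set.encard_le_encard (s := T)
    (t := {b ∈ boundaryArcs C | ∃ x ∈ b, dist x q ≤ ρ ∧ ∃ y ∈ b, 40 * ρ ≤ dist x y})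
    fun b hb => ⟨(hT hb).1, q, (hT hb).2, by rw [dist_self]; exact hρ.le, y b, hyb b hb, hall b hb⟩
  have h := hle.trans (encard_long_arcs_le C q hρ)
  rw [hTc] at h
  exact absurd h (by norm_num)

/-- The boundary of a flower of `n` disks consists of linearly many arcs. -/
theorem encard_boundaryArcs_le {C : Finset Disk} (hC : IsStabbedClique C) :
    (boundaryArcs C).encard ≤ C.card * 25 := by
  have hsub : boundaryArcs C ⊆ (Disk.circle '' (C : Set Disk)) ∪
      ⋃ q ∈ crossings C, {b ∈ boundaryArcs C | q ∈ b} := by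
    intro b hb
    rcases eq_circle_or_exists_crossing hb with ⟨D, hD, h⟩ | ⟨q, hq, hqb⟩
    · exact Or.inl ⟨D, hD, h⟩
    · right
      simp only [Set.mem_iUnion]
      exact ⟨q, hq, hb, hqb⟩
  have hcr := encard_crossings_le hC
  have hfin : (crossings C).Finite := by
    rw [← Set.encard_lt_top_iff]
    exact hcr.trans_lt (by exact_mod_cast ENat.natCast_lt_top (C.card * 3))
  have h1 := Set.encard_biUnion_le_mul (fun q => {b ∈ boundaryArcs C | q ∈ b}) hfin hcr
    (fun q _ => encard_arcs_through_le C q)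
  have h2 := Set.encard_image_le Disk.circle (C : Set Disk)
  rw [Set.encard_coe_eq_coe_finsetCard] at h2
  refine (Set.encard_le_encard hsub).trans ((Set.encard_union_le _ _).trans
    ((add_le_add h2 h1).trans ?_))
  -- At most n full circles, and 8 arcs through each of 3n crossings: 25n.
  norm_cast
  omega

/-! ### Charging intersections to the shorter arc. -/

theorem exists_uniform_cover : ∃ M : ℕ, ∀ (o : Plane) (d : ℝ), 0 < d → ∃ T : Finset Plane,
    T.card ≤ M ∧ ∀ x, dist x o ≤ 2 * d → ∃ t ∈ T, dist x t ≤ d / 100 := by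
  classical
  obtain ⟨t, -, htf, htc⟩ := (isCompact_closedBall (0 : Plane) 2).finite_cover_balls
    (show (0 : ℝ) < 1 / 100 by norm_num)
  refine ⟨htf.toFinset.card, fun o d hd => ⟨htf.toFinset.image fun y => o + d • y,
    Finset.card_image_le, fun x hx => ?_⟩⟩
  have hx' : d⁻¹ • (x - o) ∈ Metric.closedBall (0 : Plane) 2 := by
    rw [mem_closedBall_zero_iff, norm_smul, ← dist_eq_norm, Real.norm_of_nonneg (by positivity),
      inv_mul_le_iff₀ hd]
    linarith
  obtain ⟨y, hy, hxy⟩ := Set.mem_iUnion₂.1 (htc hx')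
  refine ⟨o + d • y, Finset.mem_image_of_mem _ (htf.mem_toFinset.2 hy), ?_⟩
  have e : x - (o + d • y) = d • (d⁻¹ • (x - o) - y) := by
    rw [smul_sub, smul_inv_smul₀ hd.ne']
    abel
  rw [dist_eq_norm, e, norm_smul, Real.norm_of_nonneg hd.le, ← dist_eq_norm]
  have := Metric.mem_ball.1 hxy
  nlinarith

/-- A disk of diameter at least `d` contains, for each point `x` of its boundary circle, a disk of
diameter `d` whose center is at distance at most `d / 2` from `x`. -/
theorem Disk.exists_subdisk (D : Disk) {x : Plane} {d : ℝ} (hd : 0 < d) (hr : d ≤ 2 * D.radius)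
    (hx : x ∈ D.circle) :
    ∃ z, dist z x ≤ d / 2 ∧ Metric.closedBall z (d / 2) ⊆ D.toSet := by
  have hrp := D.radius_pos
  have hx' : dist D.center x = D.radius := by rw [dist_comm]; exact hx
  set s := d / (2 * D.radius) with hs
  have hs0 : 0 ≤ s := by positivity
  have hs1 : s ≤ 1 := (div_le_one (by positivity)).2 hr
  have hsr : s * D.radius = d / 2 := by
    rw [hs]
    field_simp
  refine ⟨AffineMap.lineMap x D.center s, ?_, Metric.closedBall_subset_closedBall' ?_⟩
  · rw [dist_lineMap_left, dist_comm x, hx', Real.norm_of_nonneg hs0, hsr]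
  · rw [dist_lineMap_right, dist_comm x, hx', Real.norm_of_nonneg (by linarith), sub_mul, hsr]
    linarith

theorem isBounded_of_mem_boundaryArcs {C : Finset Disk} {b : Set Plane} (hb : b ∈ boundaryArcs C) :
    Bornology.IsBounded b := by
  obtain ⟨D, -, hbS, -⟩ := exists_disk_of_mem_boundaryArcs hb
  exact Metric.isBounded_sphere.subset fun y hy => (hbS hy).1

theorem diam_pos_of_mem_boundaryArcs {C : Finset Disk} {b : Set Plane} (hb : b ∈ boundaryArcs C) :
    0 < Metric.diam b := by
  obtain ⟨x, hx, y, hy, hxy⟩ := hb.1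
  exact (dist_pos.2 hxy).trans_le
    (Metric.dist_le_diam_of_mem (isBounded_of_mem_boundaryArcs hb) hx hy)

theorem exists_far_of_diam {b : Set Plane} {x : Plane} {d : ℝ} (hd : 0 < d)
    (h : d ≤ Metric.diam b) : ∃ y ∈ b, 40 * (d / 100) ≤ dist x y := by
  by_contra! hcon
  have : Metric.diam b ≤ 2 * (40 * (d / 100)) :=
    Metric.diam_le_of_subset_closedBall (by positivity) fun y hy => by
      rw [Metric.mem_closedBall, dist_comm]
      exact (hcon y hy).le
  linarith

section Family

variable {ι : Type*} (C : ι → Finset Disk)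

theorem encard_flowers_le (q : Plane) :
    {i | q ∈ flower (C i)}.encard ≤ ply fun i => flower (C i) :=
  le_iSup (fun q : Plane => {i | q ∈ flower (C i)}.encard) q

/-- The arcs of the family that are at least as long as `A` and meet it. -/
def longerNeighbors (A : Set Plane) : Set (ι × Set Plane) :=
  {b | b.2 ∈ boundaryArcs (C b.1) ∧ Metric.diam A ≤ Metric.diam b.2 ∧ (A ∩ b.2).Nonempty}

/-- The sample set `T` is used twice. A point near the center of a subdisk of diameter `d` restricts
the flower to the set `J` of at most M · ply indices; a point `t` near the intersection then leaves
at most 8 long arcs per flower. All these centers and intersections lie within `3 / 2 * d` of `o`.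
-/
theorem encard_longerNeighbors_le [Finite ι] {M : ℕ}
    (hM : ∀ (o : Plane) (d : ℝ), 0 < d → ∃ T : Finset Plane,
      T.card ≤ M ∧ ∀ x, dist x o ≤ 2 * d → ∃ t ∈ T, dist x t ≤ d / 100)
    {i : ι} {A : Set Plane} (hA : A ∈ boundaryArcs (C i)) :
    (longerNeighbors C A).encard ≤ M * (M * (ply fun i => flower (C i)) * 8) := by
  have hd := diam_pos_of_mem_boundaryArcs hA
  set d := Metric.diam A with hdA
  obtain ⟨o, ho⟩ := hA.1.nonempty
  have hAo : ∀ x ∈ A, dist x o ≤ d := fun x hx =>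
    Metric.dist_le_diam_of_mem (isBounded_of_mem_boundaryArcs hA) hx ho
  obtain ⟨T, hTM, hT⟩ := hM o d hd
  set J : Set ι := ⋃ t ∈ T, {j | t ∈ flower (C j)} with hJ
  have hJc : J.encard ≤ M * ply fun i => flower (C i) :=
    (T.encard_biUnion_le_mul _ fun t _ => encard_flowers_le C t).trans
      (mul_le_mul_left (by exact_mod_cast hTM) _)
  let L : Plane → ι → Set (Set Plane) := fun t j => {b ∈ boundaryArcs (C j) |
    ∃ x ∈ b, dist x t ≤ d / 100 ∧ ∃ y ∈ b, 40 * (d / 100) ≤ dist x y}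
  have hsub : longerNeighbors C A ⊆ ⋃ t ∈ T, ⋃ j ∈ J, Prod.mk j '' L t j := by
    rintro ⟨j, b⟩ ⟨hb, hdb, x, hxA, hxb⟩
    obtain ⟨t, ht, hxt⟩ := hT x (by linarith [hAo x hxA])
    obtain ⟨E, hE, hbS, -⟩ := exists_disk_of_mem_boundaryArcs hb
    have hEr : d ≤ 2 * E.radius := hdb.trans
      (Metric.diam_le_of_subset_closedBall E.radius_pos.le fun y hy => E.circle_subset (hbS hy).1)
    obtain ⟨z, hzx, hz⟩ := E.exists_subdisk hd hEr (hbS hxb).1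
    obtain ⟨t', ht', hzt'⟩ := hT z (by linarith [hAo x hxA, dist_triangle z x o])
    have hj : j ∈ J := by
      simp only [hJ, Set.mem_iUnion]
      refine ⟨t', ht', (flower_def _ _).2 ⟨E, hE, hz ?_⟩⟩
      rw [Metric.mem_closedBall, dist_comm]
      linarith
    simp only [Set.mem_iUnion]
    exact ⟨t, ht, j, hj, b, ⟨hb, x, hxb, hxt, exists_far_of_diam hd hdb⟩, rfl⟩
  refine (Set.encard_le_encard hsub).trans ?_
  refine (T.encard_biUnion_le_mul _ fun t _ => ?_).trans
    (mul_le_mul_left (by exact_mod_cast hTM) _)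
  refine Set.encard_biUnion_le_mul _ J.toFinite hJc fun j _ => ?_
  exact (Set.encard_image_le _ _).trans (encard_long_arcs_le (C j) t (by positivity))

theorem encard_arcs_le [Fintype ι] (hC : ∀ i, IsStabbedClique (C i)) :
    {a : ι × Set Plane | a.2 ∈ boundaryArcs (C a.1)}.encard ≤
      ((∑ i, (C i).card : ℕ) : ℕ∞) * 25 := by
  have hsub : {a : ι × Set Plane | a.2 ∈ boundaryArcs (C a.1)} ⊆
      ⋃ i ∈ (Finset.univ : Finset ι), Prod.mk i '' boundaryArcs (C i) := by
    rintro ⟨i, b⟩ hb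
    simp only [Set.mem_iUnion]
    exact ⟨i, Finset.mem_univ i, b, hb, rfl⟩
  refine (Set.encard_le_encard hsub).trans ((Finset.encard_biUnion_le _ _).trans ?_)
  push_cast
  rw [Finset.sum_mul]
  exact Finset.sum_le_sum fun i _ =>
    (Set.encard_image_le _ _).trans (encard_boundaryArcs_le (hC i))

theorem encard_components_le {i j : ι} {a b : Set Plane} (ha : a ∈ boundaryArcs (C i))
    (hb : b ∈ boundaryArcs (C j)) :
    {I | ∃ x ∈ a ∩ b, I = connectedComponentIn (a ∩ b) x}.encard ≤ 2 := by
  obtain ⟨D, -, haS, -⟩ := exists_disk_of_mem_boundaryArcs ha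
  obtain ⟨E, -, hbS, -⟩ := exists_disk_of_mem_boundaryArcs hb
  exact encard_components_inter_le D E (isPreconnected_of_mem_boundaryArcs ha)
    (isPreconnected_of_mem_boundaryArcs hb) (fun x hx => (haS hx).1) fun x hx => (hbS hx).1

/-- The arc intersections in which the first arc is not longer than the second one. -/
theorem encard_ordered_arcIntersections_le [Fintype ι] (hC : ∀ i, IsStabbedClique (C i)) {M : ℕ}
    (hM : ∀ (o : Plane) (d : ℝ), 0 < d → ∃ T : Finset Plane,
      T.card ≤ M ∧ ∀ x, dist x o ≤ 2 * d → ∃ t ∈ T, dist x t ≤ d / 100) :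
    {s ∈ arcIntersections C | Metric.diam s.1.2 ≤ Metric.diam s.2.1.2}.encard ≤
      ((∑ i, (C i).card : ℕ) : ℕ∞) * 25 * (M * (M * (ply fun i => flower (C i)) * 8) * 2) := by
  set Arcs := {a : ι × Set Plane | a.2 ∈ boundaryArcs (C a.1)} with hArcs
  have hAc := encard_arcs_le C hC
  have hfin : Arcs.Finite := by
    rw [← Set.encard_lt_top_iff]
    exact hAc.trans_lt (by exact_mod_cast ENat.natCast_lt_top _)
  have hsub : {s ∈ arcIntersections C | Metric.diam s.1.2 ≤ Metric.diam s.2.1.2} ⊆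
      ⋃ a ∈ Arcs, ⋃ b ∈ longerNeighbors C a.2, (fun I => (a, b, I)) ''
        {I | ∃ x ∈ a.2 ∩ b.2, I = connectedComponentIn (a.2 ∩ b.2) x} := by
    rintro ⟨a, b, I⟩ ⟨⟨ha, hb, -, x, hx, hI⟩, hd⟩
    simp only [Set.mem_iUnion]
    exact ⟨a, ha, b, ⟨hb, hd, x, hx⟩, I, ⟨x, hx, hI⟩, rfl⟩
  refine (Set.encard_le_encard hsub).trans ?_
  refine Set.encard_biUnion_le_mul _ hfin hAc fun a ha => ?_
  refine Set.encard_biUnion_le_mul _ (hfin.subset fun b hb => hb.1)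
    (encard_longerNeighbors_le C hM ha) fun b hb => ?_
  exact (Set.encard_image_le _ _).trans (encard_components_le C ha hb.1)

theorem encard_arcIntersections_le_two_mul :
    (arcIntersections C).encard ≤
      2 * {s ∈ arcIntersections C | Metric.diam s.1.2 ≤ Metric.diam s.2.1.2}.encard := by
  set S := {s ∈ arcIntersections C | Metric.diam s.1.2 ≤ Metric.diam s.2.1.2} with hS
  have hsub : arcIntersections C ⊆ S ∪ (fun s => (s.2.1, s.1, s.2.2)) '' S := by
    rintro ⟨a, b, I⟩ h
    rcases le_total (Metric.diam a.2) (Metric.diam b.2) with hd | hd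
    · exact Or.inl ⟨h, hd⟩
    · refine Or.inr ⟨(b, a, I), ⟨?_, hd⟩, rfl⟩
      obtain ⟨ha, hb, hab, x, hx, hI⟩ := h
      refine ⟨hb, ha, hab.symm, x, hx.symm, ?_⟩
      rw [Set.inter_comm b.2 a.2]
      exact hI
  refine (Set.encard_le_encard hsub).trans ((Set.encard_union_le _ _).trans ?_)
  rw [two_mul]
  exact add_le_add le_rfl (Set.encard_image_le _ _)

end Family

theorem lemma3 :
    ∃ K : ℕ, ∀ (ι : Type*) [Fintype ι] (C : ι → Finset Disk) (n : ℕ),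
      (∀ i, IsStabbedClique (C i)) →
      ∑ i, (C i).card = n →
      (arcIntersections C).encard ≤ (K : ℕ∞) * ((n : ℕ∞) * ply (fun i => flower (C i))) := by
  obtain ⟨M, hM⟩ := exists_uniform_cover
  -- 800 = 2 · 25 · 8 · 2: orders of the pair, arcs per disk, long arcs per sample point and flower,
  -- components per pair.
  refine ⟨800 * M ^ 2, fun ι _ C n hC hn => ?_⟩
  refine (encard_arcIntersections_le_two_mul C).trans
    ((mul_le_mul_right (encard_ordered_arcIntersections_le C hC hM) 2).trans (le_of_eq ?_))
  rw [hn]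
  push_cast
  ring
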